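/- Let $G$ be a finite group, $V$ a finite-dimensional complex representation of $G$, $u\in G$ a central element of order $2$ which acts on $V$ by $-1$, and $B\in S^2V\subset V\otimes V$ a symmetric tensor. The Hopf algebra $A(G,V,u,B)$ is defined as follows. Let $\mathbb{C}[G\ltimes V]=\mathbb{C}[G]\ltimes\Lambda V$ be the Hopf superalgebra generated by $G$ and $V$, with $gvg^{-1}=g\cdot v$, in which each $g\in G$ is even with $\Delta(g)=g\otimes g$, $\varepsilon(g)=1$, and each $v\in V$ is odd with $\Delta(v)=v\otimes 1+1\otimes v$, $\varepsilon(v)=0$. Put $J=e^B$ and $\Delta^J(x)=J^{-1}\Delta(x)J$, computed in the super tensor square of $\mathbb{C}[G\ltimes V]$. For $x$ of parity $p(x)$ write $\Delta^J(x)=\Delta_0(x)+\Delta_1(x)$, where the second tensor factors of $\Delta_0(x)$ are even and those of $\Delta_1(x)$ are odd. Then $A(G,V,u,B)$ is the algebra $\mathbb{C}[G\ltimes V]$ with the counit $\varepsilon$ and the coproduct $$x\longmapsto \Delta_0(x)-(-1)^{p(x)}(u\otimes 1)\Delta_1(x),$$ where the multiplication by $u\otimes 1$ is in the ordinary tensor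 product; it is an ordinary Hopf algebra. Let $A(G,V,u,B)^*$ be its dual space with the algebra structure $(\varphi\psi)(x)=(\varphi\otimes\psi)(\text{coproduct of }x)$ and unit $\varepsilon$. Regard $B$ as a symmetric bilinear form on $V^*$. For $g\in G$ let $B^g(x,y)=B(gx,gy)$, with $G$ acting on $V^*$ by the dual representation. Since $u$ acts by $-1$, $B^g=B^{gu}$; for $h=\{g,gu\}\in G/\langle u\rangle$ write $B^h=B^g$. For a symmetric bilinear form $b$ on a vector space $W$, let $\mathrm{Cl}(W,b)$ be the quotient of the tensor algebra of $W$ by the relations $vw+wv=2b(v,w)$. Then there is an isomorphism of $\mathbb{C}$-algebras $$A(G,V,u,B)^*\;\cong\;\bigoplus_{h\in G/\langle u\rangle}\mathrm{Cl}\!\left(V^*\oplus\mathbb{C},\ \begin{pmatrix}B-B^h&0\\0&1\end{pmatrix}\right).$$ -/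

import Mathlib

open scoped TensorProduct

noncomputable section

namespace SuperTwist

variable {G V : Type*} [Group G] [AddCommGroup V] [Module ℂ V]

/-- The exterior algebra `Λ V` of a representation `ρ : G → GL(V)`, regarded as an algebra on which
`G` acts by the algebra automorphisms `Λ(ρ g)`. -/
@[nolint unusedArguments]
def Ext (_ρ : Representation ℂ G V) : Type _ := ExteriorAlgebra ℂ V

instance (ρ : Representation ℂ G V) : Ring (Ext ρ) := inferInstanceAs (Ring (ExteriorAlgebra ℂ V))

instance (ρ : Representation ℂ G V) : Algebra ℂ (Ext ρ) :=
  inferInstanceAs (Algebra ℂ (ExteriorAlgebra ℂ V))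

/-- The identity map `Λ V → Ext ρ`. -/
def Ext.of (ρ : Representation ℂ G V) : ExteriorAlgebra ℂ V ≃ₐ[ℂ] Ext ρ := AlgEquiv.refl

instance (ρ : Representation ℂ G V) : MulSemiringAction G (Ext ρ) where
  smul g x := Ext.of ρ (ExteriorAlgebra.map (ρ g) ((Ext.of ρ).symm x))
  one_smul x := by
    change Ext.of ρ (ExteriorAlgebra.map (ρ 1) ((Ext.of ρ).symm x)) = x
    rw [map_one, Module.End.one_eq_id, ExteriorAlgebra.map_id]; rfl
  mul_smul g h x := by
    change Ext.of ρ (ExteriorAlgebra.map (ρ (g * h)) ((Ext.of ρ).symm x)) =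
      Ext.of ρ (ExteriorAlgebra.map (ρ g) (ExteriorAlgebra.map (ρ h) ((Ext.of ρ).symm x)))
    rw [map_mul, Module.End.mul_eq_comp, ← ExteriorAlgebra.map_comp_map]; rfl
  smul_zero g := map_zero (ExteriorAlgebra.map (ρ g))
  smul_add g := map_add (ExteriorAlgebra.map (ρ g))
  smul_one g := map_one (ExteriorAlgebra.map (ρ g))
  smul_mul g := map_mul (ExteriorAlgebra.map (ρ g))

theorem Ext.smul_of (ρ : Representation ℂ G V) (g : G) (x : ExteriorAlgebra ℂ V) :
    g • Ext.of ρ x = Ext.of ρ (ExteriorAlgebra.map (ρ g) x) := rfl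

instance (ρ : Representation ℂ G V) : SMulCommClass G ℂ (Ext ρ) where
  smul_comm g c x := map_smul (ExteriorAlgebra.map (ρ g)) c x

theorem Ext.induction {ρ : Representation ℂ G V} {p : Ext ρ → Prop} (x : Ext ρ)
    (hc : ∀ c, p (algebraMap ℂ _ c)) (hv : ∀ v, p (Ext.of ρ (ExteriorAlgebra.ι ℂ v)))
    (hadd : ∀ a b, p a → p b → p (a + b)) (hmul : ∀ a b, p a → p b → p (a * b)) : p x :=
  ExteriorAlgebra.induction (C := fun y => p (Ext.of ρ y)) hc hv (fun _ _ => hmul _ _)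
    (fun _ _ => hadd _ _) ((Ext.of ρ).symm x)

/-- The group algebra `ℂ[G ⋉ V] = ℂ[G] ⋉ Λ V` of the supergroup `G ⋉ V`, as an algebra: the
smash product in which `g v g⁻¹ = ρ(g) v`. The element `SkewMonoidAlgebra.single g a` is `a · g`. -/
def SuperGroupAlgebra (ρ : Representation ℂ G V) : Type _ := SkewMonoidAlgebra (Ext ρ) G

instance (ρ : Representation ℂ G V) : Ring (SuperGroupAlgebra ρ) :=
  inferInstanceAs (Ring (SkewMonoidAlgebra (Ext ρ) G))

instance (ρ : Representation ℂ G V) : Algebra ℂ (SuperGroupAlgebra ρ) :=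
  inferInstanceAs (Algebra ℂ (SkewMonoidAlgebra (Ext ρ) G))

variable (ρ : Representation ℂ G V)

/-- The coefficient `a_g ∈ Λ V` of `g` in `x = ∑ a_g · g`, as a linear function of `x`. -/
def coeff (g : G) : SuperGroupAlgebra ρ →ₗ[ℂ] Ext ρ where
  toFun x := SkewMonoidAlgebra.coeff x g
  map_add' x y := congrArg (· g) (SkewMonoidAlgebra.coeff_add x y)
  map_smul' c x := congrArg (· g) (SkewMonoidAlgebra.coeff_smul c x)

variable {ρ} in
theorem coeff_ext {x y : SuperGroupAlgebra ρ} (h : ∀ g, coeff ρ g x = coeff ρ g y) : x = y :=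
  SkewMonoidAlgebra.ext h

/-- The inclusion `Λ V → ℂ[G ⋉ V]`. -/
def extHom : Ext ρ →ₐ[ℂ] SuperGroupAlgebra ρ :=
  { (SkewMonoidAlgebra.singleOneRingHom : Ext ρ →+* SkewMonoidAlgebra (Ext ρ) G) with
    commutes' := fun _ => rfl }

/-- The inclusion `V → ℂ[G ⋉ V]`. -/
def vec : V →ₗ[ℂ] SuperGroupAlgebra ρ :=
  (extHom ρ).toLinearMap ∘ₗ (Ext.of ρ).toLinearMap ∘ₗ ExteriorAlgebra.ι ℂ

/-- The inclusion `G → ℂ[G ⋉ V]`. -/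
def grp : G →* SuperGroupAlgebra ρ := SkewMonoidAlgebra.of (Ext ρ) G

theorem vec_apply (v : V) : vec ρ v = extHom ρ (Ext.of ρ (ExteriorAlgebra.ι ℂ v)) := rfl

theorem vec_mul_self (v : V) : vec ρ v * vec ρ v = 0 := by
  rw [vec_apply, ← map_mul, ← map_mul, ExteriorAlgebra.ι_sq_zero, map_zero, map_zero]

theorem single_eq (g : G) (a : Ext ρ) :
    (SkewMonoidAlgebra.single g a : SkewMonoidAlgebra (Ext ρ) G) = extHom ρ a * grp ρ g := by
  refine Eq.symm ((SkewMonoidAlgebra.single_mul_single (k := Ext ρ)).trans ?_)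
  rw [one_mul, smul_one, mul_one]

theorem grp_mul_extHom (g : G) (a : Ext ρ) :
    grp ρ g * extHom ρ a = extHom ρ (g • a) * grp ρ g := by
  refine (SkewMonoidAlgebra.single_mul_single (k := Ext ρ)).trans
    (Eq.trans ?_ (SkewMonoidAlgebra.single_mul_single (k := Ext ρ)).symm)
  rw [one_mul, one_mul, mul_one, smul_one, mul_one]

theorem grp_mul_vec (g : G) (v : V) : grp ρ g * vec ρ v = vec ρ (ρ g v) * grp ρ g := by
  rw [vec_apply, vec_apply, grp_mul_extHom, Ext.smul_of, ExteriorAlgebra.map_apply_ι]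

theorem vec_mul_vec (v w : V) : vec ρ v * vec ρ w = -(vec ρ w * vec ρ v) := by
  have := vec_mul_self ρ (v + w)
  simp only [map_add, add_mul, mul_add, vec_mul_self, zero_add, add_zero] at this
  exact eq_neg_of_add_eq_zero_right this

section Lift

variable {ρ} {R : Type*} [Ring R] [Algebra ℂ R]

theorem lift_aux {f : V →ₗ[ℂ] R} {γ : G →* R} {hf : ∀ v, f v * f v = 0}
    (hγ : ∀ g v, γ g * f v = f (ρ g v) * γ g) (x : Ext ρ) (g : G) :
    ((ExteriorAlgebra.lift ℂ ⟨f, hf⟩).comp (Ext.of ρ).symm.toAlgHom) (g • x) * γ g =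
      γ g * ((ExteriorAlgebra.lift ℂ ⟨f, hf⟩).comp (Ext.of ρ).symm.toAlgHom) x := by
  induction x using Ext.induction with
  | hc r => simp [Algebra.commutes, smul_algebraMap]
  | hv x => simp [Ext.smul_of, hγ]
  | hmul a b ha hb => rw [smul_mul', map_mul, mul_assoc, hb, ← mul_assoc, ha, mul_assoc, map_mul]
  | hadd a b ha hb => rw [smul_add, map_add, add_mul, ha, hb, map_add, mul_add]

/-- The universal property of `ℂ[G ⋉ V]`. -/
def liftHom (f : V →ₗ[ℂ] R) (γ : G →* R) (hf : ∀ v, f v * f v = 0)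
    (hγ : ∀ g v, γ g * f v = f (ρ g v) * γ g) : SuperGroupAlgebra ρ →ₐ[ℂ] R :=
  (SkewMonoidAlgebra.liftNCAlgHom
    ((ExteriorAlgebra.lift ℂ ⟨f, hf⟩).comp (Ext.of ρ).symm.toAlgHom) γ
    (fun {x y} => lift_aux hγ x y) : SkewMonoidAlgebra (Ext ρ) G →ₐ[ℂ] R)

@[simp]
theorem liftHom_vec (f : V →ₗ[ℂ] R) (γ : G →* R) (hf : ∀ v, f v * f v = 0)
    (hγ : ∀ g v, γ g * f v = f (ρ g v) * γ g) (v : V) : liftHom f γ hf hγ (vec ρ v) = f v := by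
  refine (SkewMonoidAlgebra.liftNC_single _ _ _ _).trans ?_
  rw [map_one, mul_one]
  exact ExteriorAlgebra.lift_ι_apply ℂ f hf v

@[simp]
theorem liftHom_grp (f : V →ₗ[ℂ] R) (γ : G →* R) (hf : ∀ v, f v * f v = 0)
    (hγ : ∀ g v, γ g * f v = f (ρ g v) * γ g) (g : G) : liftHom f γ hf hγ (grp ρ g) = γ g := by
  refine (SkewMonoidAlgebra.liftNC_single _ _ _ _).trans ?_
  exact (congrArg (· * γ g) (map_one (ExteriorAlgebra.lift ℂ ⟨f, hf⟩))).trans (one_mul _)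

theorem generators_induction {p : SuperGroupAlgebra ρ → Prop} (x : SuperGroupAlgebra ρ)
    (hv : ∀ v, p (vec ρ v)) (hg : ∀ g, p (grp ρ g)) (hc : ∀ c, p (algebraMap ℂ _ c))
    (hadd : ∀ a b, p a → p b → p (a + b)) (hmul : ∀ a b, p a → p b → p (a * b)) : p x := by
  refine SkewMonoidAlgebra.induction_on (p := p) x ?_ (fun g a => ?_) hadd
  · have := hc 0
    rw [map_zero] at this
    exact this
  · rw [single_eq]
    refine hmul _ _ ?_ (hg g)
    induction a using Ext.induction with
    | hc r => rw [AlgHom.commutes]; exact hc r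
    | hv x => exact hv x
    | hmul a b ha hb => rw [map_mul]; exact hmul _ _ ha hb
    | hadd a b ha hb => rw [map_add]; exact hadd _ _ ha hb

theorem hom_ext {φ ψ : SuperGroupAlgebra ρ →ₐ[ℂ] R} (hv : ∀ v, φ (vec ρ v) = ψ (vec ρ v))
    (hg : ∀ g, φ (grp ρ g) = ψ (grp ρ g)) : φ = ψ := by
  refine AlgHom.ext fun x => ?_
  induction x using generators_induction with
  | hv v => exact hv v
  | hg g => exact hg g
  | hc c => rw [AlgHom.commutes, AlgHom.commutes]
  | hadd a b ha hb => rw [map_add, map_add, ha, hb]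
  | hmul a b ha hb => rw [map_mul, map_mul, ha, hb]

end Lift

section Grading

theorem zmod_two_cases (i : ZMod 2) : i = 0 ∨ i = 1 := by
  revert i; decide

/-- The even (`i = 0`) and odd (`i = 1`) parts of `Λ V`. -/
def extParity (i : ZMod 2) : Submodule ℂ (Ext ρ) :=
  (CliffordAlgebra.evenOdd (0 : QuadraticForm ℂ V) i).map (Ext.of ρ).toLinearMap

/-- The even (`i = 0`) and odd (`i = 1`) parts of the superalgebra `ℂ[G ⋉ V]`, in which `G` is even
and `V` is odd. -/
def parity (i : ZMod 2) : Submodule ℂ (SuperGroupAlgebra ρ) where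
  carrier := {x | ∀ g, coeff ρ g x ∈ extParity ρ i}
  zero_mem' := fun g => by rw [map_zero]; exact (extParity ρ i).zero_mem
  add_mem' := fun hx hy g => by rw [map_add]; exact (extParity ρ i).add_mem (hx g) (hy g)
  smul_mem' := fun c x hx g => by rw [map_smul]; exact (extParity ρ i).smul_mem c (hx g)

variable {ρ}

theorem smul_mem_extParity {i : ZMod 2} {a : Ext ρ} (g : G) (ha : a ∈ extParity ρ i) :
    g • a ∈ extParity ρ i := by
  obtain ⟨b, hb, rfl⟩ := ha
  refine ⟨ExteriorAlgebra.map (ρ g) b, ?_, rfl⟩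
  have : (CliffordAlgebra.evenOdd (0 : QuadraticForm ℂ V) i).map
      (ExteriorAlgebra.map (ρ g)).toLinearMap ≤ CliffordAlgebra.evenOdd 0 i := by
    simp only [CliffordAlgebra.evenOdd, Submodule.map_iSup, Submodule.map_pow]
    refine iSup_mono fun n => pow_le_pow_left' ?_ _
    rw [← LinearMap.range_comp]
    rintro _ ⟨v, rfl⟩
    exact ⟨ρ g v, (ExteriorAlgebra.map_apply_ι _ _).symm⟩
  exact this ⟨b, hb, rfl⟩

instance : SetLike.GradedMonoid (extParity ρ) where
  one_mem := ⟨1, SetLike.GradedOne.one_mem, rfl⟩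
  mul_mem := by
    rintro i j _ _ ⟨a, ha, rfl⟩ ⟨b, hb, rfl⟩
    exact ⟨a * b, SetLike.GradedMul.mul_mem ha hb, rfl⟩

theorem grp_mem_parity (g : G) : grp ρ g ∈ parity ρ 0 := by
  classical
  intro h
  change (Finsupp.single g (1 : Ext ρ)) h ∈ _
  rw [Finsupp.single_apply]
  split_ifs
  · exact SetLike.GradedOne.one_mem
  · exact Submodule.zero_mem _

theorem one_mem_parity : (1 : SuperGroupAlgebra ρ) ∈ parity ρ 0 := by
  rw [← map_one (grp ρ)]
  exact grp_mem_parity 1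

instance : SetLike.GradedMonoid (parity ρ) where
  one_mem := one_mem_parity
  mul_mem := fun i j x y hx hy g => by
    have h : coeff ρ g (x * y) = SkewMonoidAlgebra.sum (k := Ext ρ) x
      fun h a => a * h • SkewMonoidAlgebra.coeff (k := Ext ρ) y (h⁻¹ * g) :=
      SkewMonoidAlgebra.coeff_mul_left (k := Ext ρ) x y g
    rw [h]
    exact Submodule.sum_mem _ fun h _ =>
      SetLike.GradedMul.mul_mem (hx h) (smul_mem_extParity _ (hy _))

/-- The projection of `Λ V` onto its even or odd part. -/
def extProj (i : ZMod 2) : Ext ρ →ₗ[ℂ] Ext ρ :=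
  (Ext.of ρ).toLinearMap ∘ₗ
    (GradedAlgebra.proj (CliffordAlgebra.evenOdd (0 : QuadraticForm ℂ V)) i) ∘ₗ
      (Ext.of ρ).symm.toLinearMap

theorem extProj_mem (i : ZMod 2) (a : Ext ρ) : extProj i a ∈ extParity ρ i :=
  ⟨_, SetLike.coe_mem _, rfl⟩

theorem extProj_of_mem {i : ZMod 2} {a : Ext ρ} (ha : a ∈ extParity ρ i) : extProj i a = a := by
  obtain ⟨b, hb, rfl⟩ := ha
  exact congrArg (Ext.of ρ) (DirectSum.decompose_of_mem_same _ hb)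

theorem extProj_of_mem_ne {i j : ZMod 2} {a : Ext ρ} (ha : a ∈ extParity ρ i) (h : i ≠ j) :
    extProj j a = 0 := by
  obtain ⟨b, hb, rfl⟩ := ha
  exact congrArg (Ext.of ρ) (DirectSum.decompose_of_mem_ne _ hb h)

theorem extProj_add (a : Ext ρ) : extProj 0 a + extProj 1 a = a := by
  obtain ⟨a, rfl⟩ := (Ext.of ρ).surjective a
  induction a using DirectSum.Decomposition.inductionOn
    (CliffordAlgebra.evenOdd (0 : QuadraticForm ℂ V)) with
  | zero => simp
  | @homogeneous i m =>
    have h : Ext.of ρ (m : ExteriorAlgebra ℂ V) ∈ extParity ρ i := ⟨_, m.2, rfl⟩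
    obtain rfl | rfl := zmod_two_cases i
    · rw [extProj_of_mem h, extProj_of_mem_ne h (by decide), add_zero]
    · rw [extProj_of_mem h, extProj_of_mem_ne h (by decide), zero_add]
  | add m n hm hn => rw [map_add, map_add, map_add, add_add_add_comm, hm, hn]

/-- The projection of `ℂ[G ⋉ V]` onto its even or odd part. -/
def parityProj (i : ZMod 2) : SuperGroupAlgebra ρ →ₗ[ℂ] SuperGroupAlgebra ρ :=
  (SkewMonoidAlgebra.coeffLinearEquiv.symm.toLinearMap ∘ₗ
    Finsupp.mapRange.linearMap (extProj i) ∘ₗ SkewMonoidAlgebra.coeffLinearEquiv.toLinearMap :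
    SkewMonoidAlgebra (Ext ρ) G →ₗ[ℂ] SkewMonoidAlgebra (Ext ρ) G)

theorem coeff_parityProj (i : ZMod 2) (x : SuperGroupAlgebra ρ) (g : G) :
    coeff ρ g (parityProj i x) = extProj i (coeff ρ g x) := rfl

theorem parityProj_mem (i : ZMod 2) (x : SuperGroupAlgebra ρ) : parityProj i x ∈ parity ρ i :=
  fun _ => extProj_mem i _

theorem parityProj_of_mem {i : ZMod 2} {x : SuperGroupAlgebra ρ} (hx : x ∈ parity ρ i) :
    parityProj i x = x :=
  coeff_ext fun g => extProj_of_mem (hx g)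

theorem parityProj_of_mem_ne {i j : ZMod 2} {x : SuperGroupAlgebra ρ} (hx : x ∈ parity ρ i)
    (h : i ≠ j) : parityProj j x = 0 :=
  coeff_ext fun g => by
    rw [coeff_parityProj, map_zero]
    exact extProj_of_mem_ne (hx g) h

theorem parityProj_add (x : SuperGroupAlgebra ρ) : parityProj 0 x + parityProj 1 x = x :=
  coeff_ext fun g => by
    rw [map_add, coeff_parityProj, coeff_parityProj]
    exact extProj_add _

instance : GradedAlgebra (parity ρ) where
  toDecomposition := DirectSum.Decomposition.ofLinearMap (parity ρ)
    (DirectSum.lof ℂ (ZMod 2) (fun i => parity ρ i) 0 ∘ₗ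
        (parityProj 0).codRestrict _ (parityProj_mem 0) +
      DirectSum.lof ℂ (ZMod 2) (fun i => parity ρ i) 1 ∘ₗ
        (parityProj 1).codRestrict _ (parityProj_mem 1))
    (by
      refine LinearMap.ext fun x => ?_
      simp only [LinearMap.comp_apply, LinearMap.add_apply, map_add, DirectSum.coeLinearMap_lof,
        LinearMap.id_apply]
      exact parityProj_add x)
    (by
      refine DirectSum.linearMap_ext _ fun i => LinearMap.ext fun x => ?_
      simp only [LinearMap.comp_apply, LinearMap.add_apply, DirectSum.coeLinearMap_lof,
        LinearMap.id_apply]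
      obtain rfl | rfl := zmod_two_cases i
      · have h0 : (parityProj 0).codRestrict _ (parityProj_mem 0) (x : SuperGroupAlgebra ρ) = x :=
          Subtype.ext (parityProj_of_mem x.2)
        have h1 : (parityProj 1).codRestrict _ (parityProj_mem 1) (x : SuperGroupAlgebra ρ) = 0 :=
          Subtype.ext (parityProj_of_mem_ne x.2 (by decide))
        rw [h0, h1, map_zero, add_zero]
      · have h0 : (parityProj 1).codRestrict _ (parityProj_mem 1) (x : SuperGroupAlgebra ρ) = x :=
          Subtype.ext (parityProj_of_mem x.2)
        have h1 : (parityProj 0).codRestrict _ (parityProj_mem 0) (x : SuperGroupAlgebra ρ) = 0 :=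
          Subtype.ext (parityProj_of_mem_ne x.2 (by decide))
        rw [h0, h1, map_zero, zero_add])

theorem mul_mem_parity {i j k : ZMod 2} {x y : SuperGroupAlgebra ρ} (hx : x ∈ parity ρ i)
    (hy : y ∈ parity ρ j) (h : i + j = k) : x * y ∈ parity ρ k := by
  subst h
  exact SetLike.GradedMul.mul_mem hx hy

theorem parityProj_zero_mul (x y : SuperGroupAlgebra ρ) : parityProj 0 (x * y) =
    parityProj 0 x * parityProj 0 y + parityProj 1 x * parityProj 1 y := by
  have h0 := parityProj_mem (ρ := ρ) 0
  have h1 := parityProj_mem (ρ := ρ) 1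
  conv_lhs => rw [← parityProj_add x, ← parityProj_add y]
  simp only [add_mul, mul_add, map_add]
  rw [parityProj_of_mem (mul_mem_parity (h0 x) (h0 y) (by decide)),
    parityProj_of_mem (mul_mem_parity (h1 x) (h1 y) (by decide)),
    parityProj_of_mem_ne (mul_mem_parity (h0 x) (h1 y) (zero_add 1)) (by decide),
    parityProj_of_mem_ne (mul_mem_parity (h1 x) (h0 y) (add_zero 1)) (by decide)]
  simp

theorem parityProj_one_mul (x y : SuperGroupAlgebra ρ) : parityProj 1 (x * y) =
    parityProj 0 x * parityProj 1 y + parityProj 1 x * parityProj 0 y := by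
  have h0 := parityProj_mem (ρ := ρ) 0
  have h1 := parityProj_mem (ρ := ρ) 1
  conv_lhs => rw [← parityProj_add x, ← parityProj_add y]
  simp only [add_mul, mul_add, map_add]
  rw [parityProj_of_mem_ne (mul_mem_parity (h0 x) (h0 y) (zero_add 0)) (by decide),
    parityProj_of_mem_ne (mul_mem_parity (h1 x) (h1 y) (show (1 + 1 : ZMod 2) = 0 by decide))
      (by decide),
    parityProj_of_mem (mul_mem_parity (h0 x) (h1 y) (zero_add 1)),
    parityProj_of_mem (mul_mem_parity (h1 x) (h0 y) (add_zero 1))]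
  simp [add_comm]

theorem vec_mem_parity (v : V) : vec ρ v ∈ parity ρ 1 := by
  classical
  intro g
  change (Finsupp.single (1 : G) (Ext.of ρ (ExteriorAlgebra.ι ℂ v))) g ∈ _
  rw [Finsupp.single_apply]
  split_ifs
  · exact ⟨_, CliffordAlgebra.ι_mem_evenOdd_one _ v, rfl⟩
  · exact Submodule.zero_mem _

end Grading

section Exponential

variable {R S : Type*} [Ring R] [Algebra ℂ R] [Ring S] [Algebra ℂ S]

/-- The exponential `∑ xᵏ / k!` of a nilpotent element `x` of a `ℂ`-algebra. -/
def nilExp (x : R) : R :=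
  letI : Module ℚ R := Module.compHom R (algebraMap ℚ ℂ)
  IsNilpotent.exp x

theorem nilExp_zero : nilExp (0 : R) = 1 :=
  let _ : Module ℚ R := Module.compHom R (algebraMap ℚ ℂ)
  IsNilpotent.exp_zero

theorem nilExp_add {x y : R} (h : Commute x y) (hx : IsNilpotent x) (hy : IsNilpotent y) :
    nilExp (x + y) = nilExp x * nilExp y :=
  let _ : Module ℚ R := Module.compHom R (algebraMap ℚ ℂ)
  IsNilpotent.exp_add_of_commute h hx hy

theorem nilExp_neg_mul {x : R} (hx : IsNilpotent x) : nilExp (-x) * nilExp x = 1 :=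
  let _ : Module ℚ R := Module.compHom R (algebraMap ℚ ℂ)
  IsNilpotent.exp_neg_mul_exp_self hx

theorem nilExp_mul_neg {x : R} (hx : IsNilpotent x) : nilExp x * nilExp (-x) = 1 :=
  let _ : Module ℚ R := Module.compHom R (algebraMap ℚ ℂ)
  IsNilpotent.exp_mul_exp_neg_self hx

theorem map_nilExp (f : R →ₐ[ℂ] S) {x : R} (hx : IsNilpotent x) : f (nilExp x) = nilExp (f x) :=
  let _ : Module ℚ R := Module.compHom R (algebraMap ℚ ℂ)
  let _ : Module ℚ S := Module.compHom S (algebraMap ℚ ℂ)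
  IsNilpotent.map_exp hx f

theorem nilExp_eq_sum {x : R} {n : ℕ} (hx : x ^ n = 0) :
    ∃ c : ℕ → ℂ, c 0 = 1 ∧ nilExp x = ∑ k ∈ Finset.range n, c k • x ^ k := by
  let _ : Module ℚ R := Module.compHom R (algebraMap ℚ ℂ)
  exact ⟨fun k => algebraMap ℚ ℂ ((k.factorial : ℚ)⁻¹), by simp, IsNilpotent.exp_eq_sum hx⟩

theorem Commute.nilExp_right {x y : R} (h : Commute y x) (hx : IsNilpotent x) :
    Commute y (nilExp x) := by
  obtain ⟨n, hn⟩ := hx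
  obtain ⟨c, -, h'⟩ := nilExp_eq_sum hn
  rw [h']
  exact Commute.sum_right _ _ _ fun k _ => (h.pow_right k).smul_right _

end Exponential

section SuperTensor

open GradedTensorProduct

/-- The tensor product `ℂ[G ⋉ V] ⊗ ℂ[G ⋉ V]` of superalgebras, with its multiplication
`(a ⊗ b)(a' ⊗ b') = (-1)^{|b||a'|} aa' ⊗ bb'`. -/
abbrev SuperTensor : Type _ := parity ρ ᵍ⊗[ℂ] parity ρ

variable {ρ}

@[simp]
theorem zero_tmul (a : SuperGroupAlgebra ρ) : (0 ᵍ⊗ₜ a : SuperTensor ρ) = 0 :=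
  TensorProduct.zero_tmul _ a

@[simp]
theorem tmul_zero (a : SuperGroupAlgebra ρ) : (a ᵍ⊗ₜ 0 : SuperTensor ρ) = 0 :=
  TensorProduct.tmul_zero _ a

@[simp]
theorem neg_tmul (a b : SuperGroupAlgebra ρ) : ((-a) ᵍ⊗ₜ b : SuperTensor ρ) = -(a ᵍ⊗ₜ b) :=
  TensorProduct.neg_tmul a b

@[simp]
theorem tmul_neg (a b : SuperGroupAlgebra ρ) : (a ᵍ⊗ₜ (-b) : SuperTensor ρ) = -(a ᵍ⊗ₜ b) :=
  TensorProduct.tmul_neg a b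

theorem tmul_mul_of_left {b₁ a₂ : SuperGroupAlgebra ρ} (hb : b₁ ∈ parity ρ 0)
    (a₁ b₂ : SuperGroupAlgebra ρ) :
    ((a₁ ᵍ⊗ₜ b₁ : SuperTensor ρ) * a₂ ᵍ⊗ₜ b₂) = (a₁ * a₂) ᵍ⊗ₜ (b₁ * b₂) := by
  induction a₂ using DirectSum.Decomposition.inductionOn (parity ρ) with
  | zero => simp
  | @homogeneous i a => simpa using tmul_zero_coe_mul_coe_tmul (parity ρ) (parity ρ) a₁ (⟨b₁, hb⟩ : parity ρ 0) a b₂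
  | add m n hm hn => simp only [tmul, TensorProduct.add_tmul, map_add, mul_add] at *; rw [hm, hn]

theorem tmul_mul_of_right {b₁ a₂ : SuperGroupAlgebra ρ} (ha : a₂ ∈ parity ρ 0)
    (a₁ b₂ : SuperGroupAlgebra ρ) :
    ((a₁ ᵍ⊗ₜ b₁ : SuperTensor ρ) * a₂ ᵍ⊗ₜ b₂) = (a₁ * a₂) ᵍ⊗ₜ (b₁ * b₂) := by
  induction b₁ using DirectSum.Decomposition.inductionOn (parity ρ) with
  | zero => simp
  | @homogeneous i b => simpa using tmul_coe_mul_zero_coe_tmul (parity ρ) (parity ρ) a₁ b (⟨a₂, ha⟩ : parity ρ 0) b₂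
  | add m n hm hn =>
    simp only [tmul, TensorProduct.tmul_add, map_add, add_mul] at *; rw [hm, hn]

theorem tmul_mul_of_odd {b₁ a₂ : SuperGroupAlgebra ρ} (hb : b₁ ∈ parity ρ 1) (ha : a₂ ∈ parity ρ 1)
    (a₁ b₂ : SuperGroupAlgebra ρ) :
    ((a₁ ᵍ⊗ₜ b₁ : SuperTensor ρ) * a₂ ᵍ⊗ₜ b₂) = -((a₁ * a₂) ᵍ⊗ₜ (b₁ * b₂)) := by
  simpa using tmul_coe_mul_coe_tmul (parity ρ) (parity ρ) a₁ (⟨b₁, hb⟩ : parity ρ 1) (⟨a₂, ha⟩ : parity ρ 1) b₂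

variable (ρ)

/-- The comultiplication of the cocommutative Hopf superalgebra `ℂ[G ⋉ V]`: the algebra
homomorphism with `Δ v = v ⊗ 1 + 1 ⊗ v` and `Δ g = g ⊗ g`. -/
def superComul : SuperGroupAlgebra ρ →ₐ[ℂ] SuperTensor ρ :=
  liftHom ((includeLeft (parity ρ) (parity ρ)).toLinearMap ∘ₗ vec ρ +
      (includeRight (parity ρ) (parity ρ)).toLinearMap ∘ₗ vec ρ)
    { toFun := fun g => grp ρ g ᵍ⊗ₜ grp ρ g
      map_one' := by rw [map_one]; rfl
      map_mul' := fun g h => by rw [tmul_mul_of_left (grp_mem_parity g), map_mul] }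
    (fun v => by
      change (vec ρ v ᵍ⊗ₜ 1 + 1 ᵍ⊗ₜ vec ρ v : SuperTensor ρ) * (vec ρ v ᵍ⊗ₜ 1 + 1 ᵍ⊗ₜ vec ρ v) = 0
      rw [add_mul, mul_add, mul_add, tmul_mul_of_left one_mem_parity,
        tmul_mul_of_left one_mem_parity, tmul_mul_of_odd (vec_mem_parity v) (vec_mem_parity v),
        tmul_mul_of_right one_mem_parity, vec_mul_self]
      simp)
    (fun g v => by
      change (grp ρ g ᵍ⊗ₜ grp ρ g : SuperTensor ρ) * (vec ρ v ᵍ⊗ₜ 1 + 1 ᵍ⊗ₜ vec ρ v) =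
        (vec ρ (ρ g v) ᵍ⊗ₜ 1 + 1 ᵍ⊗ₜ vec ρ (ρ g v)) * (grp ρ g ᵍ⊗ₜ grp ρ g)
      rw [add_mul, mul_add, tmul_mul_of_left (grp_mem_parity g),
        tmul_mul_of_left (grp_mem_parity g), tmul_mul_of_right (grp_mem_parity g),
        tmul_mul_of_right (grp_mem_parity g), grp_mul_vec]
      simp)

/-- The inclusion `V ⊗ V → ℂ[G ⋉ V] ⊗ ℂ[G ⋉ V]`. -/
def tensorIncl : V ⊗[ℂ] V →ₗ[ℂ] SuperTensor ρ :=
  (GradedTensorProduct.of ℂ (parity ρ) (parity ρ)).toLinearMap ∘ₗ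
    TensorProduct.map (vec ρ) (vec ρ)

variable {ρ}

theorem superComul_vec (v : V) : superComul ρ (vec ρ v) = vec ρ v ᵍ⊗ₜ 1 + 1 ᵍ⊗ₜ vec ρ v :=
  liftHom_vec _ _ _ _ _

theorem superComul_grp (g : G) : superComul ρ (grp ρ g) = grp ρ g ᵍ⊗ₜ grp ρ g :=
  liftHom_grp _ _ _ _ _

theorem tensorIncl_tmul (v w : V) : tensorIncl ρ (v ⊗ₜ w) = vec ρ v ᵍ⊗ₜ vec ρ w := rfl

theorem tensorIncl_commute (b c : V ⊗[ℂ] V) : Commute (tensorIncl ρ b) (tensorIncl ρ c) := by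
  induction b using TensorProduct.induction_on with
  | zero => simp
  | add x y hx hy => rw [map_add]; exact hx.add_left hy
  | tmul v w =>
    induction c using TensorProduct.induction_on with
    | zero => simp
    | add x y hx hy => rw [map_add]; exact hx.add_right hy
    | tmul v' w' =>
      rw [tensorIncl_tmul, tensorIncl_tmul, commute_iff_eq,
        tmul_mul_of_odd (vec_mem_parity _) (vec_mem_parity _),
        tmul_mul_of_odd (vec_mem_parity _) (vec_mem_parity _), vec_mul_vec ρ v, vec_mul_vec ρ w]
      simp

theorem tensorIncl_nilpotent (b : V ⊗[ℂ] V) : IsNilpotent (tensorIncl ρ b) := by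
  induction b using TensorProduct.induction_on with
  | zero => simp
  | add x y hx hy => rw [map_add]; exact (tensorIncl_commute x y).isNilpotent_add hx hy
  | tmul v w =>
    refine ⟨2, ?_⟩
    rw [pow_two, tensorIncl_tmul, tmul_mul_of_odd (vec_mem_parity _) (vec_mem_parity _),
      vec_mul_self]
    simp

theorem tensorIncl_commute_vec (b : V ⊗[ℂ] V) (v : V) :
    Commute (superComul ρ (vec ρ v)) (tensorIncl ρ b) := by
  induction b using TensorProduct.induction_on with
  | zero => simp
  | add x y hx hy => rw [map_add]; exact hx.add_right hy
  | tmul x y =>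
    rw [superComul_vec, tensorIncl_tmul, commute_iff_eq, add_mul, mul_add,
      tmul_mul_of_left one_mem_parity, tmul_mul_of_odd (vec_mem_parity _) (vec_mem_parity _),
      tmul_mul_of_odd (vec_mem_parity _) (vec_mem_parity _), tmul_mul_of_right one_mem_parity,
      vec_mul_vec ρ v x, vec_mul_vec ρ v y]
    simp

theorem grp_mul_tensorIncl (g : G) (b : V ⊗[ℂ] V) :
    (grp ρ g ᵍ⊗ₜ grp ρ g) * tensorIncl ρ b =
      tensorIncl ρ (TensorProduct.map (ρ g) (ρ g) b) * (grp ρ g ᵍ⊗ₜ grp ρ g) := by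
  induction b using TensorProduct.induction_on with
  | zero => simp
  | add x y hx hy => rw [map_add, map_add, map_add, mul_add, hx, hy, add_mul]
  | tmul x y =>
    rw [TensorProduct.map_tmul, tensorIncl_tmul, tensorIncl_tmul,
      tmul_mul_of_left (grp_mem_parity g), tmul_mul_of_right (grp_mem_parity g), grp_mul_vec,
      grp_mul_vec]

end SuperTensor

variable (G V) in
/-- The data `(G, V, u, B)`: a representation `V` of `G`, a central element `u ∈ G` of order two
acting by `-1` on `V`, and a symmetric tensor `B ∈ S²V ⊆ V ⊗ V`. -/
structure Datum where
  /-- the action of `G` on `V` -/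
  ρ : Representation ℂ G V
  /-- the distinguished central element -/
  u : G
  u_mem_center : u ∈ Subgroup.center G
  orderOf_u : orderOf u = 2
  ρ_u : ρ u = -1
  /-- the symmetric tensor -/
  B : V ⊗[ℂ] V
  comm_B : TensorProduct.comm ℂ V V B = B

namespace Datum

open GradedTensorProduct

variable (D : Datum G V)

/-- The twist `J = e^B`. -/
def J : SuperTensor D.ρ := nilExp (tensorIncl D.ρ D.B)

/-- The inverse `J⁻¹ = e^{-B}` of the twist. -/
def Jinv : SuperTensor D.ρ := nilExp (tensorIncl D.ρ (-D.B))

theorem Jinv_mul_J : D.Jinv * D.J = 1 := by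
  rw [Jinv, J, map_neg]; exact nilExp_neg_mul (tensorIncl_nilpotent _)

theorem J_mul_Jinv : D.J * D.Jinv = 1 := by
  rw [Jinv, J, map_neg]; exact nilExp_mul_neg (tensorIncl_nilpotent _)

/-- The comultiplication `Δ^J(x) = J⁻¹ Δ(x) J` of the twisted Hopf superalgebra `ℂ[G ⋉ V]^J`. -/
def twistedComul : SuperGroupAlgebra D.ρ →ₐ[ℂ] SuperTensor D.ρ :=
  AlgHom.ofLinearMap
    (LinearMap.mulLeft ℂ D.Jinv ∘ₗ LinearMap.mulRight ℂ D.J ∘ₗ (superComul D.ρ).toLinearMap)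
    (by
      change D.Jinv * (superComul D.ρ 1 * D.J) = 1
      rw [map_one, one_mul, Jinv_mul_J])
    (fun x y => by
      change D.Jinv * (superComul D.ρ (x * y) * D.J) =
        D.Jinv * (superComul D.ρ x * D.J) * (D.Jinv * (superComul D.ρ y * D.J))
      rw [map_mul]
      simp only [mul_assoc]
      rw [← mul_assoc D.J D.Jinv, J_mul_Jinv, one_mul])

theorem twistedComul_apply (x : SuperGroupAlgebra D.ρ) :
    D.twistedComul x = D.Jinv * superComul D.ρ x * D.J := (mul_assoc _ _ _).symm

theorem twistedComul_vec (v : V) :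
    D.twistedComul (vec D.ρ v) = vec D.ρ v ᵍ⊗ₜ 1 + 1 ᵍ⊗ₜ vec D.ρ v := by
  have : Commute (superComul D.ρ (vec D.ρ v)) D.J :=
    Commute.nilExp_right (tensorIncl_commute_vec _ v) (tensorIncl_nilpotent _)
  rw [twistedComul_apply, mul_assoc, this.eq, ← mul_assoc, Jinv_mul_J, one_mul, superComul_vec]

theorem twistedComul_u :
    D.twistedComul (grp D.ρ D.u) = grp D.ρ D.u ᵍ⊗ₜ grp D.ρ D.u := by
  have h1 : TensorProduct.map (D.ρ D.u) (D.ρ D.u) D.B = D.B := by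
    rw [D.ρ_u]
    induction D.B using TensorProduct.induction_on with
    | zero => simp
    | tmul x y => simp [TensorProduct.neg_tmul, TensorProduct.tmul_neg]
    | add x y hx hy => rw [map_add, hx, hy]
  have : Commute (superComul D.ρ (grp D.ρ D.u)) D.J := by
    refine Commute.nilExp_right ?_ (tensorIncl_nilpotent _)
    rw [superComul_grp, commute_iff_eq, grp_mul_tensorIncl, h1]
  rw [twistedComul_apply, mul_assoc, this.eq, ← mul_assoc, Jinv_mul_J, one_mul, superComul_grp]

theorem u_mul_u : grp D.ρ D.u * grp D.ρ D.u = 1 := by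
  rw [← map_mul, ← pow_two, ← D.orderOf_u, pow_orderOf_eq_one, map_one]

theorem u_mul_grp (g : G) : grp D.ρ D.u * grp D.ρ g = grp D.ρ g * grp D.ρ D.u := by
  rw [← map_mul, ← map_mul, Subgroup.mem_center_iff.1 D.u_mem_center g]

theorem u_mul_vec (v : V) : grp D.ρ D.u * vec D.ρ v = -(vec D.ρ v * grp D.ρ D.u) := by
  rw [grp_mul_vec, D.ρ_u]
  simp

/-- The parity automorphism `x ↦ (-1)^{|x|} x` of the superspace `ℂ[G ⋉ V]`. -/
def sign : SuperGroupAlgebra D.ρ →ₗ[ℂ] SuperGroupAlgebra D.ρ := parityProj 0 - parityProj 1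

/-- The map `a ⊗ b ↦ a ⊗ bᵢ` from the tensor square of the superspace `ℂ[G ⋉ V]` to
`ℂ[G ⋉ V] ⊗ ℂ[G ⋉ V]ᵢ`, where `bᵢ` is the component of `b` of parity `i`. -/
def rightProj (i : ZMod 2) :
    SuperTensor D.ρ →ₗ[ℂ] SuperGroupAlgebra D.ρ ⊗[ℂ] SuperGroupAlgebra D.ρ :=
  (parityProj i).lTensor _ ∘ₗ (GradedTensorProduct.of ℂ (parity D.ρ) (parity D.ρ)).symm.toLinearMap

/-- The comultiplication of `A(G, V, u, B)`:
`Δ(x) = Δ₀(x) - (-1)^{|x|} (u ⊗ 1) Δ₁(x)`, where `Δ^J(x) = Δ₀(x) + Δ₁(x)` with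
`Δ₀(x) ∈ A ⊗ A₀` and `Δ₁(x) ∈ A ⊗ A₁`. The product with `u ⊗ 1` is taken in the usual tensor
product of algebras. -/
def comulLin : SuperGroupAlgebra D.ρ →ₗ[ℂ] SuperGroupAlgebra D.ρ ⊗[ℂ] SuperGroupAlgebra D.ρ :=
  D.rightProj 0 ∘ₗ D.twistedComul.toLinearMap -
    LinearMap.mulLeft ℂ (grp D.ρ D.u ⊗ₜ 1) ∘ₗ D.rightProj 1 ∘ₗ D.twistedComul.toLinearMap ∘ₗ D.sign

theorem comulLin_apply (x : SuperGroupAlgebra D.ρ) :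
    D.comulLin x = D.rightProj 0 (D.twistedComul x) -
      (grp D.ρ D.u ⊗ₜ 1) * D.rightProj 1 (D.twistedComul (D.sign x)) := rfl

theorem u_smul (a : ExteriorAlgebra ℂ V) :
    D.u • Ext.of D.ρ a = Ext.of D.ρ (CliffordAlgebra.involute a) := by
  have : ExteriorAlgebra.map (D.ρ D.u) = CliffordAlgebra.involute := by
    apply ExteriorAlgebra.hom_ext
    ext v
    rw [D.ρ_u]
    simp only [LinearMap.comp_apply, AlgHom.toLinearMap_apply, ExteriorAlgebra.map_apply_ι]
    exact (map_neg _ _).trans (CliffordAlgebra.involute_ι v).symm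
  rw [Ext.smul_of, this]

theorem coeff_u_mul (x : SuperGroupAlgebra D.ρ) (g : G) :
    coeff D.ρ g (grp D.ρ D.u * x) = D.u • coeff D.ρ (D.u⁻¹ * g) x :=
  (SkewMonoidAlgebra.coeff_single_mul (k := Ext D.ρ) _ _ x _).trans (one_mul _)

theorem coeff_mul_u (x : SuperGroupAlgebra D.ρ) (g : G) :
    coeff D.ρ g (x * grp D.ρ D.u) = coeff D.ρ (D.u⁻¹ * g) x := by
  have h : g * D.u⁻¹ = D.u⁻¹ * g := Subgroup.mem_center_iff.1 (inv_mem D.u_mem_center) g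
  refine (SkewMonoidAlgebra.coeff_mul_single (k := Ext D.ρ) x _ _ _).trans ?_
  rw [smul_one, mul_one, h]
  rfl

theorem u_mul_of_mem_zero {x : SuperGroupAlgebra D.ρ} (hx : x ∈ parity D.ρ 0) :
    grp D.ρ D.u * x = x * grp D.ρ D.u := by
  refine coeff_ext fun g => ?_
  rw [coeff_u_mul, coeff_mul_u]
  obtain ⟨a, ha, h⟩ := hx (D.u⁻¹ * g)
  rw [← h]
  exact (D.u_smul a).trans (congrArg (Ext.of D.ρ) (CliffordAlgebra.involute_eq_of_mem_even ha))

theorem u_mul_of_mem_one {x : SuperGroupAlgebra D.ρ} (hx : x ∈ parity D.ρ 1) :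
    grp D.ρ D.u * x = -(x * grp D.ρ D.u) := by
  refine coeff_ext fun g => ?_
  rw [map_neg, coeff_u_mul, coeff_mul_u]
  obtain ⟨a, ha, h⟩ := hx (D.u⁻¹ * g)
  rw [← h]
  exact (D.u_smul a).trans ((congrArg (Ext.of D.ρ)
    (CliffordAlgebra.involute_eq_of_mem_odd ha)).trans (map_neg _ _))

theorem sign_eq (x : SuperGroupAlgebra D.ρ) :
    D.sign x = grp D.ρ D.u * x * grp D.ρ D.u := by
  conv_rhs => rw [← parityProj_add x]
  rw [mul_add, D.u_mul_of_mem_zero (parityProj_mem 0 x), D.u_mul_of_mem_one (parityProj_mem 1 x),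
    add_mul, neg_mul, mul_assoc, mul_assoc, u_mul_u, mul_one, mul_one, ← sub_eq_add_neg]
  rfl

/-- The right tensor factor of the bosonization: the algebra homomorphism
`b ↦ u^{|b|} ⊗ b` into the usual tensor product. -/
def bosonRight : SuperGroupAlgebra D.ρ →ₐ[ℂ] SuperGroupAlgebra D.ρ ⊗[ℂ] SuperGroupAlgebra D.ρ :=
  AlgHom.ofLinearMap
    ((TensorProduct.mk ℂ _ _ 1) ∘ₗ parityProj 0 +
      (TensorProduct.mk ℂ _ _ (grp D.ρ D.u)) ∘ₗ parityProj 1)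
    (by
      change (1 : SuperGroupAlgebra D.ρ) ⊗ₜ[ℂ] parityProj 0 (1 : SuperGroupAlgebra D.ρ) +
        grp D.ρ D.u ⊗ₜ[ℂ] parityProj 1 (1 : SuperGroupAlgebra D.ρ) = 1
      rw [parityProj_of_mem one_mem_parity, parityProj_of_mem_ne one_mem_parity (by decide)]
      simp [Algebra.TensorProduct.one_def])
    (fun x y => by
      change (1 : SuperGroupAlgebra D.ρ) ⊗ₜ[ℂ] parityProj 0 (x * y) +
          grp D.ρ D.u ⊗ₜ[ℂ] parityProj 1 (x * y) =
        ((1 : SuperGroupAlgebra D.ρ) ⊗ₜ[ℂ] parityProj 0 x + grp D.ρ D.u ⊗ₜ[ℂ] parityProj 1 x) *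
        ((1 : SuperGroupAlgebra D.ρ) ⊗ₜ[ℂ] parityProj 0 y + grp D.ρ D.u ⊗ₜ[ℂ] parityProj 1 y)
      rw [parityProj_zero_mul, parityProj_one_mul]
      simp only [add_mul, mul_add, Algebra.TensorProduct.tmul_mul_tmul, one_mul, mul_one, u_mul_u,
        TensorProduct.tmul_add]
      abel)

theorem bosonRight_of_mem_zero {x : SuperGroupAlgebra D.ρ} (hx : x ∈ parity D.ρ 0) :
    D.bosonRight x = 1 ⊗ₜ x := by
  change 1 ⊗ₜ parityProj 0 x + grp D.ρ D.u ⊗ₜ parityProj 1 x = _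
  rw [parityProj_of_mem hx, parityProj_of_mem_ne hx (by decide), TensorProduct.tmul_zero, add_zero]

theorem bosonRight_of_mem_one {x : SuperGroupAlgebra D.ρ} (hx : x ∈ parity D.ρ 1) :
    D.bosonRight x = grp D.ρ D.u ⊗ₜ x := by
  change 1 ⊗ₜ parityProj 0 x + grp D.ρ D.u ⊗ₜ parityProj 1 x = _
  rw [parityProj_of_mem hx, parityProj_of_mem_ne hx (by decide), TensorProduct.tmul_zero, zero_add]

/-- The bosonization homomorphism `a ⊗ b ↦ a u^{|b|} ⊗ b` from the super tensor product to the
usual tensor product. -/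
def boson : SuperTensor D.ρ →ₐ[ℂ] SuperGroupAlgebra D.ρ ⊗[ℂ] SuperGroupAlgebra D.ρ :=
  GradedTensorProduct.lift _ _ Algebra.TensorProduct.includeLeft D.bosonRight (by
    rintro i j ⟨a, ha⟩ ⟨b, hb⟩
    obtain rfl | rfl := zmod_two_cases j
    · simp [D.bosonRight_of_mem_zero hb]
    · obtain rfl | rfl := zmod_two_cases i
      · simp [D.bosonRight_of_mem_one hb, D.u_mul_of_mem_zero ha]
      · simp [D.bosonRight_of_mem_one hb, D.u_mul_of_mem_one ha, TensorProduct.neg_tmul])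

theorem boson_tmul (a b : SuperGroupAlgebra D.ρ) :
    D.boson (a ᵍ⊗ₜ b) = (a ⊗ₜ 1) * D.bosonRight b := rfl

theorem boson_tmul_of_mem_zero (a : SuperGroupAlgebra D.ρ) {b : SuperGroupAlgebra D.ρ}
    (hb : b ∈ parity D.ρ 0) : D.boson (a ᵍ⊗ₜ b) = a ⊗ₜ b := by
  rw [boson_tmul, bosonRight_of_mem_zero _ hb]; simp

theorem boson_tmul_of_mem_one (a : SuperGroupAlgebra D.ρ) {b : SuperGroupAlgebra D.ρ}
    (hb : b ∈ parity D.ρ 1) : D.boson (a ᵍ⊗ₜ b) = (a * grp D.ρ D.u) ⊗ₜ b := by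
  rw [boson_tmul, bosonRight_of_mem_one _ hb]; simp

theorem comulLin_eq (x : SuperGroupAlgebra D.ρ) : D.comulLin x = D.boson (D.twistedComul x) := by
  have h : D.twistedComul (D.sign x) = (grp D.ρ D.u ᵍ⊗ₜ grp D.ρ D.u) * D.twistedComul x *
      (grp D.ρ D.u ᵍ⊗ₜ grp D.ρ D.u) := by
    rw [sign_eq, map_mul D.twistedComul, map_mul D.twistedComul, twistedComul_u]
  rw [comulLin_apply, h]
  generalize D.twistedComul x = y
  obtain ⟨y, rfl⟩ := (GradedTensorProduct.of ℂ (parity D.ρ) (parity D.ρ)).surjective y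
  induction y using TensorProduct.induction_on with
  | zero => simp
  | add a b ha hb =>
    rw [map_add, map_add, map_add, mul_add, add_mul, map_add, mul_add, ← ha, ← hb]
    abel
  | tmul a b =>
    change D.rightProj 0 (a ᵍ⊗ₜ b) - _ * D.rightProj 1 (_ * (a ᵍ⊗ₜ b) * _) = D.boson (a ᵍ⊗ₜ b)
    have hu := grp_mem_parity (ρ := D.ρ) D.u
    rw [tmul_mul_of_left hu, tmul_mul_of_right hu]
    induction b using DirectSum.Decomposition.inductionOn (parity D.ρ) with
    | zero => simp [rightProj]
    | add m n hm hn =>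
      have e : ∀ c d e : SuperGroupAlgebra D.ρ,
          (c ᵍ⊗ₜ (d + e) : SuperTensor D.ρ) = c ᵍ⊗ₜ d + c ᵍ⊗ₜ e :=
        fun c d e => TensorProduct.tmul_add c d e
      rw [mul_add, add_mul, e, e, map_add, map_add, map_add, mul_add, ← hm, ← hn]
      abel
    | @homogeneous i b =>
      obtain ⟨b, hb⟩ := b
      have r : ∀ j c d, D.rightProj j (c ᵍ⊗ₜ d) = c ⊗ₜ parityProj j d := fun _ _ _ => rfl
      obtain rfl | rfl := zmod_two_cases i
      · have hb' : grp D.ρ D.u * b * grp D.ρ D.u = b := by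
          rw [D.u_mul_of_mem_zero hb, mul_assoc, u_mul_u, mul_one]
        simp only [r]
        rw [hb', parityProj_of_mem hb, parityProj_of_mem_ne hb (by decide),
          D.boson_tmul_of_mem_zero _ hb]
        simp
      · have hb' : grp D.ρ D.u * b * grp D.ρ D.u = -b := by
          rw [D.u_mul_of_mem_one hb, neg_mul, mul_assoc, u_mul_u, mul_one]
        simp only [r]
        rw [hb', map_neg, parityProj_of_mem hb, parityProj_of_mem_ne hb (by decide),
          D.boson_tmul_of_mem_one _ hb, Algebra.TensorProduct.tmul_mul_tmul, ← mul_assoc,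
          ← mul_assoc, u_mul_u]
        simp [TensorProduct.tmul_neg]

/-- The comultiplication of `A(G, V, u, B)` as an algebra homomorphism. -/
def comulHom :
    SuperGroupAlgebra D.ρ →ₐ[ℂ] SuperGroupAlgebra D.ρ ⊗[ℂ] SuperGroupAlgebra D.ρ :=
  AlgHom.ofLinearMap D.comulLin (by rw [comulLin_eq, map_one, map_one])
    (fun x y => by simp only [comulLin_eq, map_mul])

theorem comulHom_apply (x : SuperGroupAlgebra D.ρ) :
    D.comulHom x = D.boson (D.twistedComul x) := D.comulLin_eq x

end Datum

namespace Datum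

open GradedTensorProduct Algebra.TensorProduct

variable (D : Datum G V)

/-- The counit of `A(G, V, u, B)`: `ε(g) = 1` and `ε(v) = 0`. -/
def counitHom : SuperGroupAlgebra D.ρ →ₐ[ℂ] ℂ :=
  liftHom 0 1 (fun _ => by simp) (fun _ _ => by simp)

theorem counitHom_vec (v : V) : D.counitHom (vec D.ρ v) = 0 := by simp [counitHom]

theorem counitHom_grp (g : G) : D.counitHom (grp D.ρ g) = 1 := by simp [counitHom]

/-- The image of `V ⊗ V` under bosonization: `v ⊗ w ↦ v u ⊗ w`. -/
def inc (b : V ⊗[ℂ] V) : SuperGroupAlgebra D.ρ ⊗[ℂ] SuperGroupAlgebra D.ρ :=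
  D.boson (tensorIncl D.ρ b)

theorem inc_tmul (v w : V) : D.inc (v ⊗ₜ w) = (vec D.ρ v * grp D.ρ D.u) ⊗ₜ vec D.ρ w :=
  D.boson_tmul_of_mem_one _ (vec_mem_parity w)

theorem inc_add (a b : V ⊗[ℂ] V) : D.inc (a + b) = D.inc a + D.inc b := by
  rw [inc, map_add, map_add]; rfl

theorem inc_neg (b : V ⊗[ℂ] V) : D.inc (-b) = -D.inc b := by
  rw [inc, map_neg, map_neg]; rfl

theorem inc_zero : D.inc 0 = 0 := by
  rw [inc, map_zero, map_zero]

theorem inc_nilpotent (b : V ⊗[ℂ] V) : IsNilpotent (D.inc b) :=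
  (tensorIncl_nilpotent b).map D.boson

theorem comulHom_vec (v : V) :
    D.comulHom (vec D.ρ v) = vec D.ρ v ⊗ₜ 1 + grp D.ρ D.u ⊗ₜ vec D.ρ v := by
  rw [comulHom_apply, twistedComul_vec, map_add, boson_tmul_of_mem_zero _ _ one_mem_parity,
    boson_tmul_of_mem_one _ _ (vec_mem_parity v), one_mul]

theorem comulHom_u : D.comulHom (grp D.ρ D.u) = grp D.ρ D.u ⊗ₜ grp D.ρ D.u := by
  rw [comulHom_apply, twistedComul_u, boson_tmul_of_mem_zero _ _ (grp_mem_parity _)]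

theorem comulHom_grp (g : G) : D.comulHom (grp D.ρ g) =
    nilExp (D.inc (-D.B)) * (grp D.ρ g ⊗ₜ grp D.ρ g) * nilExp (D.inc D.B) := by
  rw [comulHom_apply, twistedComul_apply, map_mul, map_mul, superComul_grp,
    boson_tmul_of_mem_zero _ _ (grp_mem_parity _), J, Jinv,
    map_nilExp _ (tensorIncl_nilpotent _), map_nilExp _ (tensorIncl_nilpotent _)]
  rfl

theorem vecU_mul_vecU (v w : V) : vec D.ρ v * grp D.ρ D.u * (vec D.ρ w * grp D.ρ D.u) =
    -(vec D.ρ v * vec D.ρ w) := by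
  rw [mul_assoc, ← mul_assoc (grp D.ρ D.u), u_mul_vec, neg_mul, mul_assoc, u_mul_u, mul_one,
    mul_neg]

theorem vecU_mul_vec (v w : V) : vec D.ρ v * grp D.ρ D.u * vec D.ρ w =
    vec D.ρ w * (vec D.ρ v * grp D.ρ D.u) := by
  rw [mul_assoc, u_mul_vec, mul_neg, ← mul_assoc, vec_mul_vec, neg_mul, neg_neg, mul_assoc]

/-- Shorthand for the algebra `ℂ[G ⋉ V]`. -/
local notation "𝔸" => SuperGroupAlgebra D.ρ

/-- `x ↦ x ⊗ 1` into the triple tensor product. -/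
def i12 : 𝔸 ⊗[ℂ] 𝔸 →ₐ[ℂ] 𝔸 ⊗[ℂ] (𝔸 ⊗[ℂ] 𝔸) :=
  (Algebra.TensorProduct.assoc ℂ ℂ ℂ 𝔸 𝔸 𝔸).toAlgHom.comp includeLeft

/-- `x ↦ 1 ⊗ x` into the triple tensor product. -/
def i23 : 𝔸 ⊗[ℂ] 𝔸 →ₐ[ℂ] 𝔸 ⊗[ℂ] (𝔸 ⊗[ℂ] 𝔸) := includeRight

/-- `Δ ⊗ id` -/
def comulL : 𝔸 ⊗[ℂ] 𝔸 →ₐ[ℂ] 𝔸 ⊗[ℂ] (𝔸 ⊗[ℂ] 𝔸) :=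
  (Algebra.TensorProduct.assoc ℂ ℂ ℂ 𝔸 𝔸 𝔸).toAlgHom.comp
    (Algebra.TensorProduct.map D.comulHom (.id ℂ 𝔸))

/-- `id ⊗ Δ` -/
def comulR : 𝔸 ⊗[ℂ] 𝔸 →ₐ[ℂ] 𝔸 ⊗[ℂ] (𝔸 ⊗[ℂ] 𝔸) :=
  Algebra.TensorProduct.map (.id ℂ 𝔸) D.comulHom

theorem i12_tmul (a b : 𝔸) : D.i12 (a ⊗ₜ b) = a ⊗ₜ (b ⊗ₜ 1) := rfl
theorem i23_tmul (a b : 𝔸) : D.i23 (a ⊗ₜ b) = 1 ⊗ₜ (a ⊗ₜ b) := rfl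

theorem comulL_tmul (a b : 𝔸) :
    D.comulL (a ⊗ₜ b) = Algebra.TensorProduct.assoc ℂ ℂ ℂ 𝔸 𝔸 𝔸 (D.comulHom a ⊗ₜ b) := rfl

theorem comulR_tmul (a b : 𝔸) : D.comulR (a ⊗ₜ b) = a ⊗ₜ D.comulHom b := rfl

theorem comulL_tmul_inc (v w : V) : D.comulL (D.inc (v ⊗ₜ w)) =
    (vec D.ρ v * grp D.ρ D.u) ⊗ₜ (grp D.ρ D.u ⊗ₜ vec D.ρ w) + D.i23 (D.inc (v ⊗ₜ w)) := by
  rw [inc_tmul, i23_tmul]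
  rw [comulL_tmul, map_mul, comulHom_vec, comulHom_u, add_mul, tmul_mul_tmul, tmul_mul_tmul, one_mul, u_mul_u,
    TensorProduct.add_tmul, map_add]
  rfl

theorem comulR_tmul_inc (v w : V) : D.comulR (D.inc (v ⊗ₜ w)) =
    D.i12 (D.inc (v ⊗ₜ w)) + (vec D.ρ v * grp D.ρ D.u) ⊗ₜ (grp D.ρ D.u ⊗ₜ vec D.ρ w) := by
  rw [inc_tmul, i12_tmul]
  rw [comulR_tmul, comulHom_vec, TensorProduct.tmul_add]

theorem comul_inc (b : V ⊗[ℂ] V) :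
    D.i12 (D.inc b) + D.comulL (D.inc b) = D.i23 (D.inc b) + D.comulR (D.inc b) := by
  induction b using TensorProduct.induction_on with
  | zero => simp [inc_zero]
  | add x y hx hy =>
    simp only [inc_add, map_add]
    rw [add_add_add_comm, hx, hy, add_add_add_comm]
  | tmul v w => rw [comulL_tmul_inc, comulR_tmul_inc]; abel

theorem commute_L (b c : V ⊗[ℂ] V) : Commute (D.i12 (D.inc b)) (D.comulL (D.inc c)) := by
  induction b using TensorProduct.induction_on with
  | zero => simp [inc_zero]
  | add x y hx hy => rw [inc_add, map_add]; exact hx.add_left hy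
  | tmul v w =>
    induction c using TensorProduct.induction_on with
    | zero => simp [inc_zero]
    | add x y hx hy => rw [inc_add, map_add]; exact hx.add_right hy
    | tmul v' w' =>
      rw [comulL_tmul_inc, inc_tmul, inc_tmul, i12_tmul, i23_tmul]
      refine Commute.add_right ?_ ?_
      · rw [commute_iff_eq]
        simp only [tmul_mul_tmul, vecU_mul_vecU, u_mul_vec, one_mul, mul_one]
        rw [vec_mul_vec D.ρ v]
        simp [TensorProduct.neg_tmul, TensorProduct.tmul_neg]
      · rw [commute_iff_eq]
        simp only [tmul_mul_tmul, one_mul, mul_one, vecU_mul_vec]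

theorem commute_R (b c : V ⊗[ℂ] V) : Commute (D.i23 (D.inc b)) (D.comulR (D.inc c)) := by
  induction b using TensorProduct.induction_on with
  | zero => simp [inc_zero]
  | add x y hx hy => rw [inc_add, map_add]; exact hx.add_left hy
  | tmul v w =>
    induction c using TensorProduct.induction_on with
    | zero => simp [inc_zero]
    | add x y hx hy => rw [inc_add, map_add]; exact hx.add_right hy
    | tmul v' w' =>
      rw [comulR_tmul_inc, inc_tmul, inc_tmul, i12_tmul, i23_tmul]
      refine Commute.add_right ?_ ?_
      · rw [commute_iff_eq]
        simp only [tmul_mul_tmul, one_mul, mul_one, vecU_mul_vec]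
      · rw [commute_iff_eq]
        have h : grp D.ρ D.u * (vec D.ρ v * grp D.ρ D.u) = -vec D.ρ v := by
          rw [← mul_assoc, u_mul_vec, neg_mul, mul_assoc, u_mul_u, mul_one]
        have h' : vec D.ρ v * grp D.ρ D.u * grp D.ρ D.u = vec D.ρ v := by
          rw [mul_assoc, u_mul_u, mul_one]
        simp only [tmul_mul_tmul, one_mul, mul_one, h, h']
        rw [vec_mul_vec D.ρ w]
        simp [TensorProduct.neg_tmul, TensorProduct.tmul_neg]

theorem exp_L (b : V ⊗[ℂ] V) : D.i12 (nilExp (D.inc b)) * D.comulL (nilExp (D.inc b)) =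
    nilExp (D.i12 (D.inc b) + D.comulL (D.inc b)) := by
  rw [nilExp_add (D.commute_L b b) ((D.inc_nilpotent b).map _) ((D.inc_nilpotent b).map _),
    map_nilExp _ (D.inc_nilpotent b), map_nilExp _ (D.inc_nilpotent b)]

theorem exp_R (b : V ⊗[ℂ] V) : D.i23 (nilExp (D.inc b)) * D.comulR (nilExp (D.inc b)) =
    nilExp (D.i12 (D.inc b) + D.comulL (D.inc b)) := by
  rw [comul_inc, nilExp_add (D.commute_R b b) ((D.inc_nilpotent b).map _)
    ((D.inc_nilpotent b).map _), map_nilExp _ (D.inc_nilpotent b), map_nilExp _ (D.inc_nilpotent b)]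

theorem exp_L' (b : V ⊗[ℂ] V) : D.comulL (nilExp (D.inc b)) * D.i12 (nilExp (D.inc b)) =
    nilExp (D.i12 (D.inc b) + D.comulL (D.inc b)) := by
  rw [add_comm, nilExp_add (D.commute_L b b).symm ((D.inc_nilpotent b).map _)
    ((D.inc_nilpotent b).map _), map_nilExp _ (D.inc_nilpotent b), map_nilExp _ (D.inc_nilpotent b)]

theorem exp_R' (b : V ⊗[ℂ] V) : D.comulR (nilExp (D.inc b)) * D.i23 (nilExp (D.inc b)) =
    nilExp (D.i12 (D.inc b) + D.comulL (D.inc b)) := by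
  rw [comul_inc, add_comm, nilExp_add (D.commute_R b b).symm ((D.inc_nilpotent b).map _)
    ((D.inc_nilpotent b).map _), map_nilExp _ (D.inc_nilpotent b), map_nilExp _ (D.inc_nilpotent b)]

theorem comul_coassoc : D.comulL.comp D.comulHom = D.comulR.comp D.comulHom := by
  apply hom_ext
  · intro v
    change D.comulL (D.comulHom _) = D.comulR (D.comulHom _)
    rw [comulHom_vec, map_add, map_add, comulL_tmul, comulL_tmul, comulR_tmul, comulR_tmul,
      comulHom_vec, comulHom_u, map_one D.comulHom, TensorProduct.add_tmul,
      map_add (Algebra.TensorProduct.assoc ℂ ℂ ℂ 𝔸 𝔸 𝔸), TensorProduct.tmul_add]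
    simp only [Algebra.TensorProduct.assoc_tmul]
    rw [add_assoc]
    rfl
  · intro g
    have hL : D.comulL (grp D.ρ g ⊗ₜ grp D.ρ g) = D.i12 (nilExp (D.inc (-D.B))) *
        (grp D.ρ g ⊗ₜ (grp D.ρ g ⊗ₜ grp D.ρ g)) * D.i12 (nilExp (D.inc D.B)) := by
      have h : D.comulHom (grp D.ρ g) ⊗ₜ[ℂ] grp D.ρ g = (nilExp (D.inc (-D.B)) ⊗ₜ[ℂ] (1 : 𝔸)) *
          ((grp D.ρ g ⊗ₜ grp D.ρ g) ⊗ₜ grp D.ρ g) * (nilExp (D.inc D.B) ⊗ₜ[ℂ] (1 : 𝔸)) := by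
        rw [tmul_mul_tmul, tmul_mul_tmul, comulHom_grp, one_mul, mul_one]
      rw [comulL_tmul, h, map_mul, map_mul]
      rfl
    have hR : D.comulR (grp D.ρ g ⊗ₜ grp D.ρ g) = D.i23 (nilExp (D.inc (-D.B))) *
        (grp D.ρ g ⊗ₜ (grp D.ρ g ⊗ₜ grp D.ρ g)) * D.i23 (nilExp (D.inc D.B)) := by
      rw [comulR_tmul]
      change _ = (1 ⊗ₜ _) * _ * (1 ⊗ₜ _)
      rw [tmul_mul_tmul, tmul_mul_tmul, comulHom_grp, one_mul, mul_one]
    change D.comulL (D.comulHom _) = D.comulR (D.comulHom _)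
    rw [comulHom_grp, map_mul, map_mul, map_mul, map_mul, hL, hR]
    have e1 := D.exp_L D.B
    have e2 := D.exp_R D.B
    have e3 := D.exp_L' (-D.B)
    have e4 := D.exp_R' (-D.B)
    calc _ = D.comulL (nilExp (D.inc (-D.B))) * D.i12 (nilExp (D.inc (-D.B))) *
          (grp D.ρ g ⊗ₜ (grp D.ρ g ⊗ₜ grp D.ρ g)) *
          (D.i12 (nilExp (D.inc D.B)) * D.comulL (nilExp (D.inc D.B))) := by simp only [mul_assoc]
      _ = D.comulR (nilExp (D.inc (-D.B))) * D.i23 (nilExp (D.inc (-D.B))) *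
          (grp D.ρ g ⊗ₜ (grp D.ρ g ⊗ₜ grp D.ρ g)) *
          (D.i23 (nilExp (D.inc D.B)) * D.comulR (nilExp (D.inc D.B))) := by rw [e1, e2, e3, e4]
      _ = _ := by simp only [mul_assoc]

theorem counit_left : (Algebra.TensorProduct.map D.counitHom (.id ℂ 𝔸)).comp D.comulHom =
    (Algebra.TensorProduct.lid ℂ 𝔸).symm := by
  have h : ∀ b, Algebra.TensorProduct.map D.counitHom (.id ℂ 𝔸) (D.inc b) = 0 := by
    intro b
    induction b using TensorProduct.induction_on with
    | zero => simp [inc_zero]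
    | add x y hx hy => rw [inc_add, map_add, hx, hy, add_zero]
    | tmul v w => rw [inc_tmul]; simp [counitHom_vec]
  apply hom_ext
  · intro v
    change Algebra.TensorProduct.map D.counitHom (.id ℂ 𝔸) (D.comulHom _) = 1 ⊗ₜ _
    rw [comulHom_vec]
    simp [counitHom_vec, counitHom_grp]
  · intro g
    change Algebra.TensorProduct.map D.counitHom (.id ℂ 𝔸) (D.comulHom _) = 1 ⊗ₜ _
    rw [comulHom_grp, map_mul, map_mul, map_nilExp _ (D.inc_nilpotent _),
      map_nilExp _ (D.inc_nilpotent _), h, h, nilExp_zero]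
    simp [counitHom_grp]

theorem counit_right : (Algebra.TensorProduct.map (.id ℂ 𝔸) D.counitHom).comp D.comulHom =
    (Algebra.TensorProduct.rid ℂ ℂ 𝔸).symm := by
  have h : ∀ b, Algebra.TensorProduct.map (.id ℂ 𝔸) D.counitHom (D.inc b) = 0 := by
    intro b
    induction b using TensorProduct.induction_on with
    | zero => simp [inc_zero]
    | add x y hx hy => rw [inc_add, map_add, hx, hy, add_zero]
    | tmul v w => rw [inc_tmul]; simp [counitHom_vec]
  apply hom_ext
  · intro v
    change Algebra.TensorProduct.map (.id ℂ 𝔸) D.counitHom (D.comulHom _) = _ ⊗ₜ 1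
    rw [comulHom_vec]
    simp [counitHom_vec]
  · intro g
    change Algebra.TensorProduct.map (.id ℂ 𝔸) D.counitHom (D.comulHom _) = _ ⊗ₜ 1
    rw [comulHom_grp, map_mul, map_mul, map_nilExp _ (D.inc_nilpotent _),
      map_nilExp _ (D.inc_nilpotent _), h, h, nilExp_zero]
    simp [counitHom_grp]

end Datum

/-- The Hopf algebra `A(G, V, u, B)`. As an algebra it is `ℂ[G ⋉ V]`. -/
def HopfAlg (D : Datum G V) : Type _ := SuperGroupAlgebra D.ρ

namespace HopfAlg

variable (D : Datum G V)

instance : Ring (HopfAlg D) := inferInstanceAs (Ring (SuperGroupAlgebra D.ρ))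

/-- The bialgebra structure of `A(G, V, u, B)`, with comultiplication `Datum.comulLin` and counit
`Datum.counitHom`. -/
instance : Bialgebra ℂ (HopfAlg D) :=
  letI : Algebra ℂ (HopfAlg D) := inferInstanceAs (Algebra ℂ (SuperGroupAlgebra D.ρ))
  Bialgebra.ofAlgHom D.comulHom D.counitHom D.comul_coassoc D.counit_left D.counit_right

theorem comul_eq (x : HopfAlg D) : Coalgebra.comul (R := ℂ) x = D.comulLin x := rfl

theorem counit_eq (x : HopfAlg D) : Coalgebra.counit (R := ℂ) x = D.counitHom x := rfl

end HopfAlg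

namespace Datum

open Algebra.TensorProduct MulOpposite

variable (D : Datum G V)

local notation "𝔸" => SuperGroupAlgebra D.ρ

/-- The antipode of `A(G, V, u, B)`, as a homomorphism to the opposite algebra: `S(g) = g⁻¹` and
`S(v) = -u v`. -/
def antipodeHom : 𝔸 →ₐ[ℂ] 𝔸ᵐᵒᵖ :=
  liftHom
    ((opLinearEquiv ℂ).toLinearMap ∘ₗ (-(LinearMap.mulLeft ℂ (grp D.ρ D.u) ∘ₗ vec D.ρ)))
    { toFun := fun g => op (grp D.ρ g⁻¹)
      map_one' := by simp
      map_mul' := fun g h => by rw [mul_inv_rev, map_mul, op_mul] }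
    (fun v => by
      change op (-(grp D.ρ D.u * vec D.ρ v)) * op (-(grp D.ρ D.u * vec D.ρ v)) = 0
      rw [← op_mul, u_mul_vec, neg_neg, vecU_mul_vecU, vec_mul_self, neg_zero, op_zero])
    (fun g v => by
      change op (grp D.ρ g⁻¹) * op (-(grp D.ρ D.u * vec D.ρ v)) =
        op (-(grp D.ρ D.u * vec D.ρ (D.ρ g v))) * op (grp D.ρ g⁻¹)
      rw [← op_mul, ← op_mul]
      congr 1
      have h : D.ρ g⁻¹ (D.ρ g v) = v := by
        rw [← Module.End.mul_apply, ← map_mul, inv_mul_cancel, map_one, Module.End.one_apply]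
      rw [neg_mul, mul_neg, ← mul_assoc, ← u_mul_grp, mul_assoc, mul_assoc, grp_mul_vec, h])

/-- The antipode of `A(G, V, u, B)` as a linear map. -/
def antipodeLin : 𝔸 →ₗ[ℂ] 𝔸 := (opLinearEquiv ℂ).symm.toLinearMap ∘ₗ D.antipodeHom.toLinearMap

theorem antipodeLin_mul (x y : 𝔸) : D.antipodeLin (x * y) = D.antipodeLin y * D.antipodeLin x := by
  change unop (D.antipodeHom (x * y)) = unop (D.antipodeHom y) * unop (D.antipodeHom x)
  rw [map_mul, unop_mul]

theorem antipodeLin_one : D.antipodeLin 1 = 1 := by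
  change unop (D.antipodeHom 1) = 1
  rw [map_one, unop_one]

theorem antipodeLin_vec (v : V) : D.antipodeLin (vec D.ρ v) = -(grp D.ρ D.u * vec D.ρ v) := by
  change unop (D.antipodeHom (vec D.ρ v)) = _
  rw [antipodeHom, liftHom_vec]
  rfl

theorem antipodeLin_grp (g : G) : D.antipodeLin (grp D.ρ g) = grp D.ρ g⁻¹ := by
  change unop (D.antipodeHom (grp D.ρ g)) = _
  rw [antipodeHom, liftHom_grp]
  rfl

theorem u_inv : D.u⁻¹ = D.u := by
  rw [inv_eq_iff_mul_eq_one, ← pow_two, ← D.orderOf_u, pow_orderOf_eq_one]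

theorem antipodeLin_vecU (v : V) : D.antipodeLin (vec D.ρ v * grp D.ρ D.u) = -vec D.ρ v := by
  rw [antipodeLin_mul, antipodeLin_vec, antipodeLin_grp, u_inv, mul_neg, ← mul_assoc, u_mul_u,
    one_mul]

/-- The map `x ⊗ y ↦ S(x) y`. -/
def convL : 𝔸 ⊗[ℂ] 𝔸 →ₗ[ℂ] 𝔸 := LinearMap.mul' ℂ 𝔸 ∘ₗ D.antipodeLin.rTensor 𝔸

/-- The map `x ⊗ y ↦ x S(y)`. -/
def convR : 𝔸 ⊗[ℂ] 𝔸 →ₗ[ℂ] 𝔸 := LinearMap.mul' ℂ 𝔸 ∘ₗ D.antipodeLin.lTensor 𝔸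

theorem convL_tmul (x y : 𝔸) : D.convL (x ⊗ₜ y) = D.antipodeLin x * y := rfl

theorem convR_tmul (x y : 𝔸) : D.convR (x ⊗ₜ y) = x * D.antipodeLin y := rfl

theorem convL_mul {X : 𝔸 ⊗[ℂ] 𝔸} {c : ℂ} (hX : D.convL X = algebraMap ℂ 𝔸 c) (Y : 𝔸 ⊗[ℂ] 𝔸) :
    D.convL (X * Y) = algebraMap ℂ 𝔸 c * D.convL Y := by
  induction Y using TensorProduct.induction_on with
  | zero => simp
  | add a b ha hb => rw [mul_add, map_add, map_add, ha, hb, mul_add]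
  | tmul a b =>
    have h : ∀ Z : 𝔸 ⊗[ℂ] 𝔸, D.convL (Z * a ⊗ₜ b) = D.antipodeLin a * D.convL Z * b := by
      intro Z
      induction Z using TensorProduct.induction_on with
      | zero => simp
      | add x y hx hy => rw [add_mul, map_add, map_add, hx, hy, mul_add, add_mul]
      | tmul x y =>
        rw [tmul_mul_tmul, convL_tmul, convL_tmul, antipodeLin_mul]
        simp only [mul_assoc]
    rw [h, hX, convL_tmul, ← Algebra.commutes, mul_assoc]

theorem convR_mul {X : 𝔸 ⊗[ℂ] 𝔸} {c : ℂ} (hX : D.convR X = algebraMap ℂ 𝔸 c) (Y : 𝔸 ⊗[ℂ] 𝔸) :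
    D.convR (Y * X) = algebraMap ℂ 𝔸 c * D.convR Y := by
  induction Y using TensorProduct.induction_on with
  | zero => simp
  | add a b ha hb => rw [add_mul, map_add, map_add, ha, hb, mul_add]
  | tmul a b =>
    have h : ∀ Z : 𝔸 ⊗[ℂ] 𝔸, D.convR (a ⊗ₜ b * Z) = a * D.convR Z * D.antipodeLin b := by
      intro Z
      induction Z using TensorProduct.induction_on with
      | zero => simp
      | add x y hx hy => rw [mul_add, map_add, map_add, hx, hy, mul_add, add_mul]
      | tmul x y =>
        rw [tmul_mul_tmul, convR_tmul, convR_tmul, antipodeLin_mul]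
        simp only [mul_assoc]
    rw [h, hX, convR_tmul, ← Algebra.commutes, mul_assoc]

/-- The multiplication map `v ⊗ w ↦ v w` on `V ⊗ V`. -/
def mulVec : V ⊗[ℂ] V →ₗ[ℂ] 𝔸 := LinearMap.mul' ℂ 𝔸 ∘ₗ TensorProduct.map (vec D.ρ) (vec D.ρ)

theorem mulVec_B : D.mulVec D.B = 0 := by
  have h : ∀ b, D.mulVec (TensorProduct.comm ℂ V V b) = -D.mulVec b := by
    intro b
    induction b using TensorProduct.induction_on with
    | zero => simp
    | add x y hx hy => rw [map_add, map_add, map_add, hx, hy, neg_add]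
    | tmul v w => exact vec_mul_vec D.ρ w v
  have h2 := h D.B
  rw [D.comm_B] at h2
  have h3 : (2 : ℂ) • D.mulVec D.B = 0 := by
    rw [two_smul]
    exact eq_neg_iff_add_eq_zero.1 h2
  exact (smul_eq_zero.1 h3).resolve_left two_ne_zero

theorem convL_inc (b : V ⊗[ℂ] V) : D.convL (D.inc b) = -D.mulVec b := by
  induction b using TensorProduct.induction_on with
  | zero => simp [inc_zero]
  | add x y hx hy => rw [inc_add, map_add, map_add, hx, hy, neg_add]
  | tmul v w => rw [inc_tmul, convL_tmul, antipodeLin_vecU, neg_mul]; rfl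

theorem convR_inc (b : V ⊗[ℂ] V) : D.convR (D.inc b) = -D.mulVec b := by
  induction b using TensorProduct.induction_on with
  | zero => simp [inc_zero]
  | add x y hx hy => rw [inc_add, map_add, map_add, hx, hy, neg_add]
  | tmul v w =>
    rw [inc_tmul, convR_tmul, antipodeLin_vec, mul_neg, mul_assoc, ← mul_assoc (grp D.ρ D.u),
      u_mul_u, one_mul]
    rfl

theorem convL_nilExp {b : V ⊗[ℂ] V} (hb : D.mulVec b = 0) : D.convL (nilExp (D.inc b)) = 1 := by
  obtain ⟨n, hn⟩ := D.inc_nilpotent b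
  obtain ⟨c, hc, h⟩ := nilExp_eq_sum (pow_eq_zero_of_le (Nat.le_succ n) hn)
  have h0 : D.convL (D.inc b) = algebraMap ℂ 𝔸 0 := by rw [convL_inc, hb, neg_zero, map_zero]
  rw [h, Finset.sum_range_succ', map_add, map_sum, Finset.sum_eq_zero, zero_add, hc, pow_zero,
    one_smul, one_def, convL_tmul, antipodeLin_one, one_mul]
  intro k _
  rw [map_smul, pow_succ', convL_mul D h0, map_zero, zero_mul, smul_zero]

theorem convR_nilExp {b : V ⊗[ℂ] V} (hb : D.mulVec b = 0) : D.convR (nilExp (D.inc b)) = 1 := by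
  obtain ⟨n, hn⟩ := D.inc_nilpotent b
  obtain ⟨c, hc, h⟩ := nilExp_eq_sum (pow_eq_zero_of_le (Nat.le_succ n) hn)
  have h0 : D.convR (D.inc b) = algebraMap ℂ 𝔸 0 := by rw [convR_inc, hb, neg_zero, map_zero]
  rw [h, Finset.sum_range_succ', map_add, map_sum, Finset.sum_eq_zero, zero_add, hc, pow_zero,
    one_smul, one_def, convR_tmul, antipodeLin_one, one_mul]
  intro k _
  rw [map_smul, pow_succ, convR_mul D h0, map_zero, zero_mul, smul_zero]

theorem convL_comul (x : 𝔸) : D.convL (D.comulHom x) = algebraMap ℂ 𝔸 (D.counitHom x) := by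
  induction x using generators_induction with
  | hv v =>
    rw [comulHom_vec, map_add, convL_tmul, convL_tmul, antipodeLin_vec, antipodeLin_grp, u_inv,
      counitHom_vec, map_zero, mul_one, neg_add_cancel]
  | hg g =>
    have hB := D.mulVec_B
    have h1 : D.convL (nilExp (D.inc (-D.B))) = algebraMap ℂ 𝔸 1 := by
      rw [map_one]; exact D.convL_nilExp (by rw [map_neg, hB, neg_zero])
    have h2 : D.convL (grp D.ρ g ⊗ₜ grp D.ρ g) = algebraMap ℂ 𝔸 1 := by
      rw [convL_tmul, antipodeLin_grp, ← map_mul, inv_mul_cancel, map_one, map_one]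
    rw [comulHom_grp, mul_assoc, convL_mul D h1, convL_mul D h2, D.convL_nilExp hB, counitHom_grp]
    simp
  | hc c => rw [AlgHom.commutes, AlgHom.commutes, Algebra.TensorProduct.algebraMap_apply, convL_tmul,
      Algebra.algebraMap_self_apply, mul_one, Algebra.algebraMap_eq_smul_one, map_smul,
      antipodeLin_one]
  | hadd a b ha hb => simp only [map_add, ha, hb]
  | hmul a b ha hb => rw [map_mul, convL_mul D ha, hb, map_mul, map_mul]

theorem convR_comul (x : 𝔸) : D.convR (D.comulHom x) = algebraMap ℂ 𝔸 (D.counitHom x) := by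
  induction x using generators_induction with
  | hv v =>
    rw [comulHom_vec, map_add, convR_tmul, convR_tmul, antipodeLin_vec, antipodeLin_one,
      counitHom_vec, map_zero, mul_one, mul_neg, ← mul_assoc, u_mul_u, one_mul, add_neg_cancel]
  | hg g =>
    have hB := D.mulVec_B
    have h1 : D.convR (nilExp (D.inc D.B)) = algebraMap ℂ 𝔸 1 := by
      rw [map_one]; exact D.convR_nilExp hB
    have h2 : D.convR (grp D.ρ g ⊗ₜ grp D.ρ g) = algebraMap ℂ 𝔸 1 := by
      rw [convR_tmul, antipodeLin_grp, ← map_mul, mul_inv_cancel, map_one, map_one]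
    rw [comulHom_grp, convR_mul D h1, convR_mul D h2,
      D.convR_nilExp (by rw [map_neg, hB, neg_zero]), counitHom_grp]
    simp
  | hc c => rw [AlgHom.commutes, AlgHom.commutes, Algebra.TensorProduct.algebraMap_apply, convR_tmul,
      Algebra.algebraMap_self_apply, antipodeLin_one, mul_one]
  | hadd a b ha hb => simp only [map_add, ha, hb]
  | hmul a b ha hb => rw [map_mul, convR_mul D hb, ha, map_mul, map_mul, Algebra.commutes]

end Datum

/-- `A(G, V, u, B)` is a Hopf algebra. -/
instance (D : Datum G V) : HopfAlgebra ℂ (HopfAlg D) where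
  antipode := D.antipodeLin
  mul_antipode_rTensor_comul := LinearMap.ext D.convL_comul
  mul_antipode_lTensor_comul := LinearMap.ext D.convR_comul

/-- The Clifford algebra `Cl(W, B)` of a symmetric bilinear form `B`, generated by `W` with the
relations `v w + w v = 2 B(v, w)`, that is, `v² = B(v, v)`. -/
abbrev Cl {W : Type*} [AddCommGroup W] [Module ℂ W] (B : LinearMap.BilinForm ℂ W) : Type _ :=
  CliffordAlgebra (LinearMap.BilinMap.toQuadraticMap B)

namespace Datum

variable (D : Datum G V)

/-- The symmetric tensor `B ∈ S²V`, regarded as the bilinear form `(x, y) ↦ (x ⊗ y)(B)` on `V^*`. -/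
def form : LinearMap.BilinForm ℂ (Module.Dual ℂ V) :=
  (TensorProduct.mk ℂ (Module.Dual ℂ V) (Module.Dual ℂ V)).compr₂
    ((TensorProduct.dualDistrib ℂ V V).flip D.B)

theorem form_apply (x y : Module.Dual ℂ V) :
    D.form x y = TensorProduct.dualDistrib ℂ V V (x ⊗ₜ y) D.B := rfl

/-- The form `B^g(x, y) = B(g x, g y)`, where `G` acts on `V^*` by the dual representation. -/
def formConj (g : G) : LinearMap.BilinForm ℂ (Module.Dual ℂ V) :=
  D.form.compl₁₂ (D.ρ.dual g) (D.ρ.dual g)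

theorem formConj_apply (g : G) (x y : Module.Dual ℂ V) :
    D.formConj g x y = D.form (D.ρ.dual g x) (D.ρ.dual g y) := rfl

theorem formConj_mul_u (g : G) : D.formConj (g * D.u) = D.formConj g := by
  have h : D.ρ.dual D.u = -1 := by
    ext x v
    rw [Representation.dual_apply, u_inv, D.ρ_u]
    simp [Module.Dual.transpose_apply]
  refine LinearMap.ext fun x => LinearMap.ext fun y => ?_
  rw [formConj_apply, formConj_apply, map_mul, h]
  simp

/-- The form `B^h` for a coset `h = {g, gu} ∈ G/⟨u⟩`: the common value of `B^g` and `B^{gu}`. -/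
def formCoset (h : G ⧸ Subgroup.zpowers D.u) : LinearMap.BilinForm ℂ (Module.Dual ℂ V) :=
  Quotient.liftOn' h D.formConj (fun a b hab => by
    rw [QuotientGroup.leftRel_apply] at hab
    obtain ⟨k, hk⟩ := Subgroup.mem_zpowers_iff.1 hab
    have hb : b = a * D.u ^ k := by rw [hk, mul_inv_cancel_left]
    subst hb
    have hu : D.u ^ (2 : ℤ) = 1 := by
      rw [zpow_ofNat, ← D.orderOf_u, pow_orderOf_eq_one]
    obtain ⟨m, rfl | rfl⟩ := Int.even_or_odd' k
    · rw [zpow_mul, hu, one_zpow, mul_one]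
    · rw [zpow_add, zpow_mul, hu, one_zpow, one_mul, zpow_one, formConj_mul_u])

theorem formCoset_mk (g : G) : D.formCoset (QuotientGroup.mk g) = D.formConj g := rfl

/-- The bilinear form `diag(B - B^h, 1)` on `V^* ⊕ ℂ`:
`((x, s), (y, t)) ↦ (B - B^h)(x, y) + s t`. -/
def blockForm (h : G ⧸ Subgroup.zpowers D.u) : LinearMap.BilinForm ℂ (Module.Dual ℂ V × ℂ) :=
  (D.form - D.formCoset h).compl₁₂ (LinearMap.fst ℂ _ ℂ) (LinearMap.fst ℂ _ ℂ) +
    (LinearMap.mul ℂ ℂ).compl₁₂ (LinearMap.snd ℂ _ ℂ) (LinearMap.snd ℂ _ ℂ)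

theorem blockForm_apply (h : G ⧸ Subgroup.zpowers D.u) (x y : Module.Dual ℂ V) (s t : ℂ) :
    D.blockForm h (x, s) (y, t) = D.form x y - D.formCoset h x y + s * t := rfl

end Datum

end SuperTwist

end

/-! Write A for A(G, V, u, B). A functional ψ acts on A by the contraction `contr ψ` = (ψ ⊗ id)Δ,
and the product of A^* is φψ = ψ ∘ `contr φ` (`dualOf_mul`), so relations in A^* are identities
between contractions. Functionals of degree at most one suffice: `dualGrp χ` : ag ↦ χ(g)ε(a) for a
function χ on G, and `dualVec f` : ag ↦ f(a₁) for f in V^*. In Δ(g) = e^{-B}(g ⊗ g)e^B they see each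
exponential only up to its linear term. Hence f contracts g to β_g(f)g with f(β_g(f)) = B^{g⁻¹}(f,
f) - B(f, f), while on products f contracts as an odd derivation, because Δ(v) = v ⊗ 1 + u ⊗ v and u
acts on V by -1.

In A^*, therefore, functions on G multiply pointwise, χ f = f χ(u·), and f² is the function g ↦
B^{g⁻¹}(f, f) - B(f, f). For a coset h let e_h be the indicator of {g : g⁻¹ ∈ h}. The e_h are
orthogonal idempotents with sum 1 and commute with V^*. Let η be a function with values ±1 and η(ug)
= -η(g). Then η² = 1 and η anticommutes with V^*, so e_h(if + tη)² = ((B - B^h)(f, f) + t²)e_h. This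
is the Clifford relation of the block h. It yields homomorphisms from the Clifford algebras to the
corners of the e_h, which add up to a homomorphism Ψ from the product to A^*.

Ψ is onto: its range contains V^*, η and the e_h, hence the point masses ½(e_h ± e_hη), and these
generate A^* (`eq_top_of_generators_mem`). For the generation, let N ⊆ A be the common kernel of a
subalgebra of A^* containing the point masses and V^*. N is stable under contraction by V^*. The
Euler operator ∑ eᵢ(eⁱ ⌟ x) acts as k modulo degree k + 1 on elements of degree at least k, which
pushes N into ever higher degrees, so N = 0. Finally both sides have dimension (|G|/2)·2^{dim V + 1}
= |G|·2^{dim V}, so Ψ is bijective. -/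

noncomputable section

namespace SuperTwist

/-! ### Clifford algebras mapping to a corner of an algebra -/

section CliffordLift

variable {M R : Type*} [AddCommGroup M] [Module ℂ M] [Ring R] [Algebra ℂ R]

/-- A linear map `γ : M → R` with values in the corner `e R e` of an idempotent `e` which satisfies
the Clifford relations `γ(m)² = Q(m) e` extends to a homomorphism from the Clifford algebra which
maps the unit to `e`. -/
theorem exists_clifford_lift (Q : QuadraticForm ℂ M) {e : R} (he : e * e = e) (γ : M →ₗ[ℂ] R)
    (hl : ∀ m, e * γ m = γ m) (hr : ∀ m, γ m * e = γ m) (hγ : ∀ m, γ m * γ m = Q m • e) :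
    ∃ ψ : CliffordAlgebra Q →ₙₐ[ℂ] R, ψ 1 = e ∧ ∀ m, ψ (CliffordAlgebra.ι Q m) = γ m := by
  -- The right ideal eR, on which left multiplication by the γ(m) defines a unital Clifford module.
  -- The homomorphism sought is the orbit map c ↦ c · e.
  let W : Submodule ℂ R := LinearMap.ker (LinearMap.mulLeft ℂ e - LinearMap.id)
  have hW : ∀ {r : R}, r ∈ W ↔ e * r = r := fun {r} => by
    simp [W, LinearMap.mem_ker, sub_eq_zero]
  let a : M →ₗ[ℂ] Module.End ℂ W :=
    { toFun := fun m => (LinearMap.mulLeft ℂ (γ m)).restrict fun x _ => hW.2 (by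
        rw [LinearMap.mulLeft_apply, ← mul_assoc, hl])
      map_add' := fun m n => by
        ext x
        simp [add_mul]
      map_smul' := fun c m => by
        ext x
        simp }
  have ha : ∀ m (x : W), (a m x : R) = γ m * x := fun m x => rfl
  let A : CliffordAlgebra Q →ₐ[ℂ] Module.End ℂ W := CliffordAlgebra.lift Q ⟨a, fun m => by
    ext x
    change γ m * (γ m * x) = Q m • (x : R)
    rw [← mul_assoc, hγ, smul_mul_assoc, hW.1 x.2]⟩
  let e' : W := ⟨e, hW.2 he⟩
  -- The Clifford action commutes with right multiplication in R, so c · x = (c · e)x.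
  -- Multiplicativity of the orbit map follows.
  have key : ∀ c (x : W), (A c x : R) = (A c e' : R) * x := by
    intro c
    induction c using CliffordAlgebra.left_induction with
    | algebraMap r =>
      intro x
      simp only [AlgHom.commutes, Module.algebraMap_end_apply, Submodule.coe_smul, smul_mul_assoc]
      rw [hW.1 x.2]
    | add c d hc hd =>
      intro x
      simp only [map_add, LinearMap.add_apply, Submodule.coe_add, add_mul, hc x, hd x]
    | ι_mul c m hc =>
      intro x
      have h : ∀ y : W, (A (CliffordAlgebra.ι Q m * c) y : R) = γ m * A c y := by
        intro y
        rw [map_mul, Module.End.mul_apply, CliffordAlgebra.lift_ι_apply, ha]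
      rw [h, h, hc x, mul_assoc]
  refine ⟨{ toFun := fun c => (A c e' : R)
            map_smul' := fun r c => by simp
            map_zero' := by simp
            map_add' := fun c d => by simp
            map_mul' := fun c d => by rw [map_mul, Module.End.mul_apply, key c] }, ?_, fun m => ?_⟩
  · change (A 1 e' : R) = e
    rw [map_one, Module.End.one_apply]
  · change (A (CliffordAlgebra.ι Q m) e' : R) = γ m
    rw [CliffordAlgebra.lift_ι_apply, ha, hr]

end CliffordLift

/-! ### Assembling homomorphisms along orthogonal idempotents -/

section Blocks

variable {ι R : Type*} [Fintype ι] [Ring R] [Algebra ℂ R] {S : ι → Type*} [∀ i, Ring (S i)]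
  [∀ i, Algebra ℂ (S i)]

/-- Homomorphisms `S i → R` which map the units to orthogonal idempotents with sum `1` assemble to
a homomorphism from the product. -/
theorem exists_pi_algHom (ψ : ∀ i, S i →ₙₐ[ℂ] R) (ho : ∀ i j, i ≠ j → ψ i 1 * ψ j 1 = 0)
    (h1 : ∑ i, ψ i 1 = 1) : ∃ Ψ : (∀ i, S i) →ₐ[ℂ] R, ∀ c, Ψ c = ∑ i, ψ i (c i) := by
  have ho' : ∀ i j, i ≠ j → ∀ c d, ψ i c * ψ j d = 0 := by
    intro i j hij c d
    rw [← mul_one c, ← one_mul d, map_mul, map_mul, mul_assoc, ← mul_assoc (ψ i 1), ho i j hij,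
      zero_mul, mul_zero]
  refine ⟨AlgHom.ofLinearMap
    { toFun := fun c => ∑ i, ψ i (c i)
      map_add' := fun c d => by simp [Finset.sum_add_distrib]
      map_smul' := fun r c => by simp [Finset.smul_sum] } h1 (fun c d => ?_), fun c => rfl⟩
  change ∑ i, ψ i (c i * d i) = (∑ i, ψ i (c i)) * ∑ j, ψ j (d j)
  rw [Finset.sum_mul_sum]
  refine Finset.sum_congr rfl fun i _ => ?_
  rw [map_mul, Finset.sum_eq_single i (fun j _ hj => ho' i j hj.symm _ _) (by simp)]

end Blocks

/-! ### Dimensions of exterior and Clifford algebras -/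

section Dimension

variable (W : Type*) [AddCommGroup W] [Module ℂ W] [FiniteDimensional ℂ W]

theorem extPower_eq_bot : (LinearMap.range (ExteriorAlgebra.ι ℂ : W →ₗ[ℂ] ExteriorAlgebra ℂ W)) ^
    (Module.finrank ℂ W + 1) = ⊥ := by
  have h := exteriorPower.finrank_eq (R := ℂ) (M := W) (n := Module.finrank ℂ W + 1)
  rw [Nat.choose_succ_self] at h
  exact Submodule.finrank_eq_zero.1 h

/-- The basis of the exterior algebra which consists of the products of basis vectors. -/
def exteriorAlgebraBasis :
    Module.Basis (Finset (Fin (Module.finrank ℂ W))) ℂ (ExteriorAlgebra ℂ W) :=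
  ((DirectSum.Decomposition.isInternal (fun i : ℕ => ⋀[ℂ]^i W)).collectedBasis
    fun i => (Module.finBasis ℂ W).exteriorPower i).reindex Set.powersetCard.prodEquiv

instance finite_exteriorAlgebra : FiniteDimensional ℂ (ExteriorAlgebra ℂ W) :=
  Module.Finite.of_basis (exteriorAlgebraBasis W)

theorem finrank_exteriorAlgebra :
    Module.finrank ℂ (ExteriorAlgebra ℂ W) = 2 ^ Module.finrank ℂ W := by
  rw [Module.finrank_eq_card_basis (exteriorAlgebraBasis W), Fintype.card_finset, Fintype.card_fin]

theorem finite_cliffordAlgebra (Q : QuadraticForm ℂ W) : FiniteDimensional ℂ (CliffordAlgebra Q) :=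
  have : Invertible (2 : ℂ) := invertibleOfNonzero two_ne_zero
  LinearEquiv.finiteDimensional (CliffordAlgebra.equivExterior Q).symm

/-- Q may be degenerate, as B - B^h can be (it vanishes for the trivial coset). Since 2 is
invertible, the Clifford algebra is linearly isomorphic to the exterior algebra whatever Q is. -/
theorem finrank_cliffordAlgebra (Q : QuadraticForm ℂ W) :
    Module.finrank ℂ (CliffordAlgebra Q) = 2 ^ Module.finrank ℂ W := by
  have : Invertible (2 : ℂ) := invertibleOfNonzero two_ne_zero
  rw [(CliffordAlgebra.equivExterior Q).finrank_eq, finrank_exteriorAlgebra]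

end Dimension

variable {G V : Type*} [Group G] [AddCommGroup V] [Module ℂ V]

/-! ### Functionals of degree zero and one on ℂ[G ⋉ V] -/

section Functionals

variable (ρ : Representation ℂ G V)

/-- The augmentation `Λ V → ℂ`. -/
def extAug : Ext ρ →ₐ[ℂ] ℂ := ExteriorAlgebra.algebraMapInv.comp (Ext.of ρ).symm.toAlgHom

/-- The projection of `Λ V` onto its component `V` of degree one. -/
def extDegOne : Ext ρ →ₗ[ℂ] V := ExteriorAlgebra.ιInv ∘ₗ (Ext.of ρ).symm.toLinearMap

variable {ρ}

theorem extAug_ι (v : V) : extAug ρ (Ext.of ρ (ExteriorAlgebra.ι ℂ v)) = 0 :=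
  ExteriorAlgebra.lift_ι_apply ℂ _ _ v

/-- The degree-one part is the second component of the homomorphism from Λ V to the square-zero
extension ℂ ⊕ V, where (0, v)(s, w) = (0, sv). -/
theorem extDegOne_ι_mul (v : V) (a : Ext ρ) :
    extDegOne ρ (Ext.of ρ (ExteriorAlgebra.ι ℂ v) * a) = extAug ρ a • v := by
  -- The square-zero extension is a bimodule construction. The right action is the one used in
  -- `ExteriorAlgebra.ιInv`.
  let : Module ℂᵐᵒᵖ V := Module.compHom _ ((RingHom.id ℂ).fromOpposite mul_comm)
  have : IsCentralScalar ℂ V := ⟨fun r m => rfl⟩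
  have h : ∀ x : ExteriorAlgebra ℂ V,
      (ExteriorAlgebra.toTrivSqZeroExt x).fst = ExteriorAlgebra.algebraMapInv x := by
    intro x
    refine AlgHom.congr_fun (φ₁ := (TrivSqZeroExt.fstHom ℂ ℂ V).comp
      ExteriorAlgebra.toTrivSqZeroExt) (ExteriorAlgebra.hom_ext (LinearMap.ext fun w => ?_)) x
    simp [ExteriorAlgebra.algebraMapInv]
  change (ExteriorAlgebra.toTrivSqZeroExt (ExteriorAlgebra.ι ℂ v * (Ext.of ρ).symm a)).snd = _
  rw [map_mul, TrivSqZeroExt.snd_mul, h, h]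
  change ExteriorAlgebra.algebraMapInv (ExteriorAlgebra.ι ℂ v) • _ +
    ExteriorAlgebra.algebraMapInv ((Ext.of ρ).symm a) • _ = ExteriorAlgebra.algebraMapInv _ • v
  simp [ExteriorAlgebra.algebraMapInv]
  rfl

theorem extDegOne_one : extDegOne ρ 1 = 0 := by
  let : Module ℂᵐᵒᵖ V := Module.compHom _ ((RingHom.id ℂ).fromOpposite mul_comm)
  have : IsCentralScalar ℂ V := ⟨fun r m => rfl⟩
  change (ExteriorAlgebra.toTrivSqZeroExt (1 : ExteriorAlgebra ℂ V)).snd = 0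
  rw [map_one, TrivSqZeroExt.snd_one]

theorem extAug_smul (g : G) (a : Ext ρ) : extAug ρ (g • a) = extAug ρ a := by
  induction a using Ext.induction with
  | hc c => rw [smul_algebraMap]
  | hv v => rw [Ext.smul_of, ExteriorAlgebra.map_apply_ι, extAug_ι, extAug_ι]
  | hmul a b ha hb => rw [smul_mul', map_mul, ha, hb, map_mul]
  | hadd a b ha hb => rw [smul_add, map_add, ha, hb, map_add]

theorem extDegOne_smul (g : G) (a : Ext ρ) : extDegOne ρ (g • a) = ρ g (extDegOne ρ a) :=
  LinearMap.congr_fun (ExteriorAlgebra.ιInv_comp_map (ρ g)) ((Ext.of ρ).symm a)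

theorem coeff_extHom_mul (a : Ext ρ) (x : SuperGroupAlgebra ρ) (g : G) :
    coeff ρ g (extHom ρ a * x) = a * coeff ρ g x := by
  refine (SkewMonoidAlgebra.coeff_single_mul (k := Ext ρ) a 1 x g).trans ?_
  rw [one_smul, inv_one, one_mul]
  rfl

theorem coeff_grp_mul (h : G) (x : SuperGroupAlgebra ρ) (g : G) :
    coeff ρ g (grp ρ h * x) = h • coeff ρ (h⁻¹ * g) x :=
  (SkewMonoidAlgebra.coeff_single_mul (k := Ext ρ) _ _ x _).trans (one_mul _)

theorem coeff_one [DecidableEq G] (g : G) : coeff ρ g 1 = if g = 1 then 1 else 0 := by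
  change (Finsupp.single (1 : G) (1 : Ext ρ)) g = _
  rw [Finsupp.single_apply]
  simp only [eq_comm]

/-- An induction principle for `ℂ[G ⋉ V]` which multiplies by vectors on the left. -/
theorem left_induction {p : SuperGroupAlgebra ρ → Prop} (x : SuperGroupAlgebra ρ)
    (hg : ∀ g, p (grp ρ g)) (hadd : ∀ x y, p x → p y → p (x + y))
    (hsmul : ∀ (c : ℂ) x, p x → p (c • x)) (hv : ∀ v x, p x → p (vec ρ v * x)) : p x := by
  refine SkewMonoidAlgebra.induction_on (p := p) x ?_ (fun g a => ?_) hadd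
  · have := hsmul 0 _ (hg 1)
    rw [zero_smul] at this
    exact this
  · rw [single_eq]
    obtain ⟨a, rfl⟩ := (Ext.of ρ).surjective a
    induction a using CliffordAlgebra.left_induction with
    | algebraMap r =>
      have : extHom ρ (Ext.of ρ (algebraMap ℂ _ r)) * grp ρ g = r • grp ρ g := by
        rw [Algebra.smul_def]
        exact congrArg (· * grp ρ g) ((extHom ρ).commutes r)
      exact this ▸ hsmul r _ (hg g)
    | add a b ha hb => rw [map_add, map_add, add_mul]; exact hadd _ _ ha hb
    | ι_mul a v ha => rw [map_mul, map_mul, mul_assoc]; exact hv v _ ha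

/-- The elements v₁⋯vₖ g span. This is the form needed later, since each contraction is described by
its value on g and its behaviour under left multiplication by v. -/
theorem linearMap_ext_left {M : Type*} [AddCommGroup M] [Module ℂ M]
    {S T : SuperGroupAlgebra ρ →ₗ[ℂ] M} (hg : ∀ g, S (grp ρ g) = T (grp ρ g))
    (hv : ∀ v x, S x = T x → S (vec ρ v * x) = T (vec ρ v * x)) : S = T :=
  LinearMap.ext fun x => left_induction x hg (fun x y hx hy => by rw [map_add, map_add, hx, hy])
    (fun c x hx => by rw [map_smul, map_smul, hx]) hv

variable (ρ) [Fintype G]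

/-- The functional `a g ↦ χ(g) ε(a)` on `ℂ[G ⋉ V]`. -/
def grpFun (χ : G → ℂ) : SuperGroupAlgebra ρ →ₗ[ℂ] ℂ :=
  ∑ g, χ g • ((extAug ρ).toLinearMap ∘ₗ coeff ρ g)

/-- The functional `a g ↦ f(a₁)` on `ℂ[G ⋉ V]`, where `a₁` is the component of `a` in `V`. -/
def vecFun : Module.Dual ℂ V →ₗ[ℂ] Module.Dual ℂ (SuperGroupAlgebra ρ) where
  toFun f := ∑ g, f ∘ₗ extDegOne ρ ∘ₗ coeff ρ g
  map_add' f f' := by simp only [LinearMap.add_comp, Finset.sum_add_distrib]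
  map_smul' c f := by simp only [LinearMap.smul_comp, Finset.smul_sum, RingHom.id_apply]

variable {ρ}

theorem grpFun_apply (χ : G → ℂ) (x : SuperGroupAlgebra ρ) :
    grpFun ρ χ x = ∑ g, χ g * extAug ρ (coeff ρ g x) := by
  simp [grpFun]

theorem vecFun_apply (f : Module.Dual ℂ V) (x : SuperGroupAlgebra ρ) :
    vecFun ρ f x = ∑ g, f (extDegOne ρ (coeff ρ g x)) := by
  simp [vecFun]

theorem grpFun_one_right (χ : G → ℂ) : grpFun ρ χ 1 = χ 1 := by
  classical
  simp [grpFun_apply, coeff_one, apply_ite]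

theorem vecFun_one_right (f : Module.Dual ℂ V) : vecFun ρ f 1 = 0 := by
  classical
  rw [vecFun_apply]
  refine Finset.sum_eq_zero fun g _ => ?_
  rw [coeff_one]
  split_ifs
  · rw [extDegOne_one, map_zero]
  · rw [map_zero, map_zero]

theorem grpFun_vec_mul (χ : G → ℂ) (v : V) (x : SuperGroupAlgebra ρ) :
    grpFun ρ χ (vec ρ v * x) = 0 := by
  simp [grpFun_apply, vec_apply, coeff_extHom_mul, extAug_ι]

theorem grpFun_grp_mul (χ : G → ℂ) (h : G) (x : SuperGroupAlgebra ρ) :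
    grpFun ρ χ (grp ρ h * x) = grpFun ρ (fun g => χ (h * g)) x := by
  simp only [grpFun_apply, coeff_grp_mul, extAug_smul]
  rw [← Equiv.sum_comp (Equiv.mulLeft h)]
  simp

theorem vecFun_vec_mul (f : Module.Dual ℂ V) (v : V) (x : SuperGroupAlgebra ρ) :
    vecFun ρ f (vec ρ v * x) = f v * grpFun ρ 1 x := by
  simp [vecFun_apply, grpFun_apply, vec_apply, coeff_extHom_mul, extDegOne_ι_mul, Finset.mul_sum,
    mul_comm]

theorem vecFun_grp_mul (f : Module.Dual ℂ V) (h : G) (x : SuperGroupAlgebra ρ) :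
    vecFun ρ f (grp ρ h * x) = vecFun ρ (f ∘ₗ ρ h) x := by
  simp only [vecFun_apply, coeff_grp_mul, extDegOne_smul]
  rw [← Equiv.sum_comp (Equiv.mulLeft h)]
  simp

theorem grpFun_grp (χ : G → ℂ) (g : G) : grpFun ρ χ (grp ρ g) = χ g := by
  rw [← mul_one (grp ρ g), grpFun_grp_mul, grpFun_one_right, mul_one]

theorem vecFun_grp (f : Module.Dual ℂ V) (g : G) : vecFun ρ f (grp ρ g) = 0 := by
  rw [← mul_one (grp ρ g), vecFun_grp_mul, vecFun_one_right]

end Functionals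

/-! ### Linear truncation of the exponential -/

section Exponential

variable {R : Type*} [Ring R] [Algebra ℂ R]

/-- The quadratic remainder is factored as x(xy) because a functional of degree at most one vanishes
after two factors from V. -/
theorem nilExp_eq_one_add {x : R} (hx : IsNilpotent x) :
    ∃ y : R, nilExp x = 1 + x + x * (x * y) := by
  let _ : Module ℚ R := Module.compHom R (algebraMap ℚ ℂ)
  obtain ⟨n, hn⟩ := hx
  -- Two terms beyond the nilpotency order are included, so that the terms of degree 0 and 1 can be
  -- split off for every n.
  have h : nilExp x = ∑ i ∈ Finset.range (n + 2), ((i.factorial : ℚ)⁻¹) • x ^ i :=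
    IsNilpotent.exp_eq_sum (pow_eq_zero_of_le (Nat.le_add_right n 2) hn)
  have hs : ∀ (q : ℚ) (a b : R), a * (q • b) = q • (a * b) := fun q a b =>
    mul_smul_comm (algebraMap ℚ ℂ q) a b
  refine ⟨∑ i ∈ Finset.range n, (((i + 2).factorial : ℚ)⁻¹) • x ^ i, ?_⟩
  rw [h, Finset.sum_range_succ', Finset.sum_range_succ', Finset.mul_sum, Finset.mul_sum]
  simp only [hs, ← pow_succ']
  simp
  abel

end Exponential

/-! ### Contractions by functionals of degree at most one -/

namespace Datum

variable (D : Datum G V)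

local notation "𝔸" => SuperGroupAlgebra D.ρ

/-- The map `x ⊗ y ↦ ψ(x) y`. -/
def slice (ψ : Module.Dual ℂ 𝔸) : 𝔸 ⊗[ℂ] 𝔸 →ₗ[ℂ] 𝔸 :=
  (TensorProduct.lid ℂ 𝔸).toLinearMap ∘ₗ ψ.rTensor 𝔸

theorem slice_tmul (ψ : Module.Dual ℂ 𝔸) (x y : 𝔸) : D.slice ψ (x ⊗ₜ y) = ψ x • y := rfl

/-- The contraction `(ψ ⊗ id) ∘ Δ` with a functional on `A(G, V, u, B)`. -/
def contr (ψ : Module.Dual ℂ 𝔸) : 𝔸 →ₗ[ℂ] 𝔸 := D.slice ψ ∘ₗ D.comulHom.toLinearMap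

theorem contr_apply (ψ : Module.Dual ℂ 𝔸) (x : 𝔸) :
    D.contr ψ x = D.slice ψ (D.comulHom x) := rfl

theorem slice_tmul_mul {ψ ψ' : Module.Dual ℂ 𝔸} {a : 𝔸} (h : ∀ x, ψ (a * x) = ψ' x) (b : 𝔸)
    (Y : 𝔸 ⊗[ℂ] 𝔸) : D.slice ψ (a ⊗ₜ b * Y) = b * D.slice ψ' Y := by
  induction Y using TensorProduct.induction_on with
  | zero => simp
  | add x y hx hy => rw [mul_add, map_add, map_add, hx, hy, mul_add]
  | tmul x y =>
    rw [Algebra.TensorProduct.tmul_mul_tmul, slice_tmul, slice_tmul, h, mul_smul_comm]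

/-- This is Δ(v) = v ⊗ 1 + u ⊗ v, with ψ' and ψ'' the translates of ψ by v and u. -/
theorem contr_vec_mul {ψ ψ' ψ'' : Module.Dual ℂ 𝔸} {v : V} (h : ∀ x, ψ (vec D.ρ v * x) = ψ' x)
    (h' : ∀ x, ψ (grp D.ρ D.u * x) = ψ'' x) (x : 𝔸) :
    D.contr ψ (vec D.ρ v * x) = D.contr ψ' x + vec D.ρ v * D.contr ψ'' x := by
  rw [contr_apply, map_mul, comulHom_vec, add_mul, map_add, D.slice_tmul_mul h,
    D.slice_tmul_mul h', one_mul]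
  rfl

variable [Fintype G]

theorem grpFun_u_mul_vec (χ : G → ℂ) (v : V) (x : 𝔸) :
    grpFun D.ρ χ (vec D.ρ v * grp D.ρ D.u * x) = 0 := by
  rw [mul_assoc, grpFun_vec_mul]

/-- The source of the sign in the odd Leibniz rule. -/
theorem vecFun_u_mul (f : Module.Dual ℂ V) (x : 𝔸) :
    vecFun D.ρ f (grp D.ρ D.u * x) = (-vecFun D.ρ f) x := by
  rw [vecFun_grp_mul, D.ρ_u]
  have : f ∘ₗ (-1 : V →ₗ[ℂ] V) = -f := by ext; simp
  rw [this, map_neg]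

theorem counit_eq_grpFun (x : 𝔸) : D.counitHom x = grpFun D.ρ 1 x := by
  refine LinearMap.congr_fun (f := D.counitHom.toLinearMap) (linearMap_ext_left ?_ ?_) x
  · intro g
    rw [grpFun_grp]
    exact D.counitHom_grp g
  · intro v x _
    rw [grpFun_vec_mul]
    change D.counitHom (vec D.ρ v * x) = 0
    rw [map_mul, counitHom_vec, zero_mul]

/-- The first tensor factor of `inc b` starts with a vector, which the augmentation kills. -/
theorem slice_grpFun_inc_mul (χ : G → ℂ) (b : V ⊗[ℂ] V) (Y : 𝔸 ⊗[ℂ] 𝔸) :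
    D.slice (grpFun D.ρ χ) (D.inc b * Y) = 0 := by
  induction b using TensorProduct.induction_on with
  | zero => simp [inc_zero]
  | add x y hx hy => rw [inc_add, add_mul, map_add, hx, hy, add_zero]
  | tmul v w =>
    rw [inc_tmul, D.slice_tmul_mul (ψ' := 0) (fun x => D.grpFun_u_mul_vec χ v x)]
    simp [slice]

/-- The contraction `v ⊗ w ↦ f(v) w` of a tensor with a covector. -/
def tensorContr (f : Module.Dual ℂ V) : V ⊗[ℂ] V →ₗ[ℂ] V :=
  (TensorProduct.lid ℂ V).toLinearMap ∘ₗ f.rTensor V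

/-- The degree-one functional spends its one degree on the first leg of b and leaves the
augmentation for Y. The factor u in `inc b` is invisible to the augmentation. -/
theorem slice_vecFun_inc_mul (f : Module.Dual ℂ V) (b : V ⊗[ℂ] V) (Y : 𝔸 ⊗[ℂ] 𝔸) :
    D.slice (vecFun D.ρ f) (D.inc b * Y) =
      vec D.ρ (tensorContr f b) * D.slice (grpFun D.ρ 1) Y := by
  induction b using TensorProduct.induction_on with
  | zero => simp [inc_zero]
  | add x y hx hy => rw [inc_add, add_mul, map_add, hx, hy, map_add, map_add, add_mul]
  | tmul v w =>
    have h : ∀ x, vecFun D.ρ f (vec D.ρ v * grp D.ρ D.u * x) = (f v • grpFun D.ρ 1) x := by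
      intro x
      rw [mul_assoc, vecFun_vec_mul, grpFun_grp_mul]
      rfl
    rw [inc_tmul, D.slice_tmul_mul h]
    have h2 : D.slice (f v • grpFun D.ρ 1) Y = f v • D.slice (grpFun D.ρ 1) Y := by
      simp [slice]
    have h3 : tensorContr f (v ⊗ₜ[ℂ] w) = f v • w := rfl
    rw [h2, h3, map_smul, mul_smul_comm, smul_mul_assoc]

theorem slice_grpFun_nilExp_mul (χ : G → ℂ) (b : V ⊗[ℂ] V) (Y : 𝔸 ⊗[ℂ] 𝔸) :
    D.slice (grpFun D.ρ χ) (nilExp (D.inc b) * Y) = D.slice (grpFun D.ρ χ) Y := by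
  obtain ⟨Z, h⟩ := nilExp_eq_one_add (D.inc_nilpotent b)
  rw [h, add_mul, add_mul, one_mul, map_add, map_add, mul_assoc, slice_grpFun_inc_mul,
    slice_grpFun_inc_mul, add_zero, add_zero]

theorem slice_vecFun_nilExp_mul (f : Module.Dual ℂ V) (b : V ⊗[ℂ] V) (Y : 𝔸 ⊗[ℂ] 𝔸) :
    D.slice (vecFun D.ρ f) (nilExp (D.inc b) * Y) = D.slice (vecFun D.ρ f) Y +
      vec D.ρ (tensorContr f b) * D.slice (grpFun D.ρ 1) Y := by
  obtain ⟨Z, h⟩ := nilExp_eq_one_add (D.inc_nilpotent b)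
  rw [h, add_mul, add_mul, one_mul, map_add, map_add, mul_assoc, slice_vecFun_inc_mul,
    slice_vecFun_inc_mul, mul_assoc, slice_grpFun_inc_mul, mul_zero, add_zero]

theorem contr_grpFun_grp (χ : G → ℂ) (g : G) :
    D.contr (grpFun D.ρ χ) (grp D.ρ g) = χ g • grp D.ρ g := by
  rw [contr_apply, comulHom_grp, mul_assoc, slice_grpFun_nilExp_mul,
    D.slice_tmul_mul (fun x => grpFun_grp_mul χ g x), ← mul_one (nilExp _),
    slice_grpFun_nilExp_mul, Algebra.TensorProduct.one_def, slice_tmul, grpFun_one_right, mul_one,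
    mul_smul_comm, mul_one]

/-- The vector `β_g(f) = g ((f ∘ g) ⌟ B) - f ⌟ B`. -/
def shift (g : G) (f : Module.Dual ℂ V) : V :=
  D.ρ g (tensorContr (f ∘ₗ D.ρ g) D.B) - tensorContr f D.B

/-- The linear terms of e^{-B} and e^B each contribute once: -(f ⌟ B)g from the left, and g((f ∘ g)
⌟ B) from the right, where the vector is then moved past g. -/
theorem contr_vecFun_grp (f : Module.Dual ℂ V) (g : G) :
    D.contr (vecFun D.ρ f) (grp D.ρ g) = vec D.ρ (D.shift g f) * grp D.ρ g := by
  rw [contr_apply, comulHom_grp, mul_assoc, slice_vecFun_nilExp_mul,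
    D.slice_tmul_mul (fun x => vecFun_grp_mul f g x),
    D.slice_tmul_mul (fun x => grpFun_grp_mul 1 g x), ← mul_one (nilExp (D.inc D.B)),
    slice_vecFun_nilExp_mul, slice_grpFun_nilExp_mul, Algebra.TensorProduct.one_def, slice_tmul,
    slice_tmul, slice_tmul, vecFun_one_right, grpFun_one_right, grpFun_one_right, zero_smul,
    zero_add, Pi.one_apply, Pi.one_apply, one_smul, mul_one, mul_one, grp_mul_vec, map_neg, map_neg,
    neg_mul, shift, map_sub, sub_mul, sub_eq_add_neg]

theorem contr_grpFun_vec_mul (χ : G → ℂ) (v : V) (x : 𝔸) : D.contr (grpFun D.ρ χ) (vec D.ρ v * x) =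
    vec D.ρ v * D.contr (grpFun D.ρ fun g => χ (D.u * g)) x := by
  rw [D.contr_vec_mul (ψ' := 0) (grpFun_vec_mul χ v) (grpFun_grp_mul χ D.u)]
  simp [contr, slice]

/-- The odd Leibniz rule, as for the contraction on Λ V. The twist enters only through the values on
G, which need not vanish here. -/
theorem contr_vecFun_vec_mul (f : Module.Dual ℂ V) (v : V) (x : 𝔸) :
    D.contr (vecFun D.ρ f) (vec D.ρ v * x) =
      f v • x - vec D.ρ v * D.contr (vecFun D.ρ f) x := by
  -- `grpFun 1` is the counit, so this is the counit axiom.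
  have h1 : D.contr (grpFun D.ρ 1) = LinearMap.id :=
    linearMap_ext_left (fun g => by simp [contr_grpFun_grp]) (fun v x hx => by
      rw [contr_grpFun_vec_mul]; exact congrArg (vec D.ρ v * ·) hx)
  rw [D.contr_vec_mul (ψ' := f v • grpFun D.ρ 1) (vecFun_vec_mul f v) (D.vecFun_u_mul f)]
  have h2 : D.contr (f v • grpFun D.ρ 1) = f v • D.contr (grpFun D.ρ 1) := by
    ext; simp [contr, slice]
  have h3 : D.contr (-vecFun D.ρ f) = -D.contr (vecFun D.ρ f) := by
    ext; simp [contr, slice]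
  rw [h2, h3, h1, LinearMap.neg_apply, mul_neg, sub_eq_add_neg]
  rfl

end Datum

/-! ### The convolution product and the functions attached to cosets of ⟨u⟩ -/

namespace Datum

variable (D : Datum G V)

local notation "𝔸" => SuperGroupAlgebra D.ρ

/-- The functionals on `ℂ[G ⋉ V]` as elements of the algebra `A(G, V, u, B)^*`. -/
def dualOf : Module.Dual ℂ 𝔸 ≃ₗ[ℂ] WithConv (HopfAlg D →ₗ[ℂ] ℂ) :=
  (WithConv.linearEquiv ℂ (HopfAlg D →ₗ[ℂ] ℂ)).symm

theorem dualOf_mul (φ ψ : Module.Dual ℂ 𝔸) :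
    D.dualOf φ * D.dualOf ψ = D.dualOf (ψ ∘ₗ D.contr φ) := by
  have h : ∀ Y : 𝔸 ⊗[ℂ] 𝔸, LinearMap.mul' ℂ ℂ (TensorProduct.map φ ψ Y) = ψ (D.slice φ Y) := by
    intro Y
    induction Y using TensorProduct.induction_on with
    | zero => simp
    | add x y hx hy => rw [map_add, map_add, map_add, map_add, hx, hy]
    | tmul x y => simp [slice_tmul]
  exact WithConv.ext (LinearMap.ext fun x => h (D.comulHom x))

theorem apply_tensorContr (f f' : Module.Dual ℂ V) (b : V ⊗[ℂ] V) :
    f' (tensorContr f b) = TensorProduct.dualDistrib ℂ V V (f ⊗ₜ f') b := by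
  induction b using TensorProduct.induction_on with
  | zero => simp
  | add x y hx hy => rw [map_add, map_add, map_add, hx, hy]
  | tmul v w => simp [tensorContr]

/-- The inverse appears because f ∘ g is the dual action of g⁻¹ on f. This is why `cosetFun` tests
g⁻¹ rather than g. -/
theorem apply_shift (g : G) (f : Module.Dual ℂ V) :
    f (D.shift g f) = D.formConj g⁻¹ f f - D.form f f := by
  have h : D.ρ.dual g⁻¹ f = f ∘ₗ D.ρ g := by
    rw [Representation.dual_apply, inv_inv]
    rfl
  rw [formConj_apply, h, form_apply, form_apply, ← apply_tensorContr, ← apply_tensorContr, shift,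
    map_sub]
  rfl

theorem u_ne_one : D.u ≠ 1 := fun h => by
  have := D.orderOf_u
  rw [h, orderOf_one] at this
  exact absurd this (by decide)

theorem mk_eq_mk_iff (a b : G) :
    (a : G ⧸ Subgroup.zpowers D.u) = b ↔ a = b ∨ a = D.u * b := by
  have hc : ∀ g, g * D.u = D.u * g := fun g => Subgroup.mem_center_iff.1 D.u_mem_center g
  have hu : D.u ^ (2 : ℤ) = 1 := by
    rw [zpow_ofNat, ← D.orderOf_u, pow_orderOf_eq_one]
  rw [eq_comm, QuotientGroup.eq, Subgroup.mem_zpowers_iff]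
  constructor
  · rintro ⟨k, h⟩
    have h' : a = b * D.u ^ k := by rw [h, mul_inv_cancel_left]
    obtain ⟨m, rfl | rfl⟩ := Int.even_or_odd' k
    · exact Or.inl (by rw [h', zpow_mul, hu, one_zpow, mul_one])
    · exact Or.inr (by rw [h', zpow_add, zpow_mul, hu, one_zpow, one_mul, zpow_one, hc])
  · rintro (rfl | rfl)
    · exact ⟨0, by simp⟩
    · exact ⟨1, by rw [← hc, zpow_one, inv_mul_cancel_left]⟩

theorem mk_u_mul (g : G) : ((D.u * g : G) : G ⧸ Subgroup.zpowers D.u) = g :=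
  (D.mk_eq_mk_iff _ _).2 (Or.inr rfl)

/-- The indicator function of the elements `g` for which `g⁻¹` lies in the coset `h`. -/
def cosetFun (h : G ⧸ Subgroup.zpowers D.u) : G → ℂ :=
  open Classical in fun g => if QuotientGroup.mk g⁻¹ = h then 1 else 0

/-- A function on `G` with values `1` and `-1` on the two elements of each coset of `⟨u⟩`. -/
def cosetSign : G → ℂ :=
  open Classical in fun g => if (g : G ⧸ Subgroup.zpowers D.u).out = g then 1 else -1

theorem cosetFun_u_mul (h : G ⧸ Subgroup.zpowers D.u) (g : G) :
    D.cosetFun h (D.u * g) = D.cosetFun h g := by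
  have : (QuotientGroup.mk (D.u * g)⁻¹ : G ⧸ Subgroup.zpowers D.u) = QuotientGroup.mk g⁻¹ := by
    rw [mul_inv_rev, u_inv, Subgroup.mem_center_iff.1 D.u_mem_center, mk_u_mul]
  simp only [cosetFun, this]

theorem cosetFun_mk_inv (g : G) : D.cosetFun (QuotientGroup.mk g⁻¹) g = 1 := if_pos rfl

theorem cosetFun_mul_self (h : G ⧸ Subgroup.zpowers D.u) :
    D.cosetFun h * D.cosetFun h = D.cosetFun h := by
  ext g
  simp only [Pi.mul_apply, cosetFun]
  split_ifs <;> simp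

theorem cosetFun_mul_of_ne {h h' : G ⧸ Subgroup.zpowers D.u} (hh : h ≠ h') :
    D.cosetFun h * D.cosetFun h' = 0 := by
  ext g
  simp only [Pi.mul_apply, cosetFun]
  split_ifs with h1 h2 <;> simp
  exact hh (h1.symm.trans h2)

theorem sum_cosetFun [Fintype (G ⧸ Subgroup.zpowers D.u)] : ∑ h, D.cosetFun h = 1 := by
  ext g
  simp [cosetFun]

theorem cosetSign_u_mul (g : G) : D.cosetSign (D.u * g) = -D.cosetSign g := by
  have h := (D.mk_eq_mk_iff (g : G ⧸ Subgroup.zpowers D.u).out g).1 (Quotient.out_eq' _)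
  have hne : g ≠ D.u * g := fun e => D.u_ne_one (right_eq_mul.1 e)
  unfold cosetSign
  rw [mk_u_mul]
  rcases h with h | h <;> rw [h]
  · rw [if_neg hne, if_pos rfl]
  · rw [if_pos rfl, if_neg hne.symm, neg_neg]

theorem cosetSign_mul_self : D.cosetSign * D.cosetSign = 1 := by
  ext g
  simp only [Pi.mul_apply, cosetSign]
  split_ifs <;> simp

/-- On the pair {g, ug} the function 1 + η(g)η takes the values 2 and 0, with η = `cosetSign`. -/
theorem single_eq_cosetFun [DecidableEq G] (g : G) : Pi.single g (1 : ℂ) = (1 / 2 : ℂ) •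
    (D.cosetFun (QuotientGroup.mk g⁻¹) +
      D.cosetSign g • (D.cosetFun (QuotientGroup.mk g⁻¹) * D.cosetSign)) := by
  have hs : D.cosetSign g * D.cosetSign g = 1 := congrFun D.cosetSign_mul_self g
  ext x
  simp only [Pi.smul_apply, Pi.add_apply, Pi.mul_apply, smul_eq_mul]
  by_cases h : (QuotientGroup.mk x⁻¹ : G ⧸ Subgroup.zpowers D.u) = QuotientGroup.mk g⁻¹
  · have hx : x = g ∨ x = D.u * g := by
      refine ((D.mk_eq_mk_iff _ _).1 h).imp inv_injective.eq_iff.1 fun h => ?_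
      rw [← inv_inv x, h, mul_inv_rev, inv_inv, u_inv, Subgroup.mem_center_iff.1 D.u_mem_center]
    rcases hx with rfl | rfl
    · rw [Pi.single_eq_same, cosetFun_mk_inv, one_mul, hs]
      norm_num
    · have hne : D.u * g ≠ g := fun e => D.u_ne_one (mul_eq_right.1 e)
      rw [Pi.single_eq_of_ne hne, cosetFun_u_mul, cosetFun_mk_inv, cosetSign_u_mul, one_mul, mul_neg,
        hs]
      norm_num
  · have hne : x ≠ g := fun e => h (by rw [e])
    have h0 : D.cosetFun (QuotientGroup.mk g⁻¹) x = 0 := if_neg h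
    rw [Pi.single_eq_of_ne hne, h0]
    simp

theorem cosetFun_mul_form (h : G ⧸ Subgroup.zpowers D.u) (m : Module.Dual ℂ V × ℂ) :
    (D.cosetFun h * fun g => D.form m.1 m.1 - D.formConj g⁻¹ m.1 m.1 + m.2 * m.2) =
      D.blockForm h m m • D.cosetFun h := by
  ext g
  simp only [Pi.mul_apply, Pi.smul_apply, smul_eq_mul, cosetFun]
  split_ifs with hg
  · rw [← hg, one_mul, mul_one]
    rfl
  · simp

/-! ### Relations in the dual algebra and the Clifford generators -/

variable [Fintype G]

theorem dualOf_one : D.dualOf (grpFun D.ρ 1) = 1 :=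
  WithConv.ext (LinearMap.ext fun x => (D.counit_eq_grpFun x).symm)

/-- This is ψ · 1 = ψ in the convolution algebra. -/
theorem grpFun_contr (ψ : Module.Dual ℂ 𝔸) : grpFun D.ρ 1 ∘ₗ D.contr ψ = ψ := by
  have h := D.dualOf_mul ψ (grpFun D.ρ 1)
  rw [dualOf_one, mul_one] at h
  exact (D.dualOf.injective h).symm

theorem grpFun_contr_apply (ψ : Module.Dual ℂ 𝔸) (x : 𝔸) : grpFun D.ρ 1 (D.contr ψ x) = ψ x :=
  LinearMap.congr_fun (D.grpFun_contr ψ) x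

/-- The element `a g ↦ χ(g) ε(a)` of `A(G, V, u, B)^*`. -/
def dualGrp : (G → ℂ) →ₗ[ℂ] WithConv (HopfAlg D →ₗ[ℂ] ℂ) where
  toFun χ := D.dualOf (grpFun D.ρ χ)
  map_add' χ χ' := by
    rw [← map_add]
    congr 1
    ext x
    simp [grpFun_apply, add_mul, Finset.sum_add_distrib]
  map_smul' c χ := by
    rw [RingHom.id_apply, ← map_smul]
    congr 1
    ext x
    simp [grpFun_apply, Finset.mul_sum, mul_assoc]

/-- The element `a g ↦ f(a₁)` of `A(G, V, u, B)^*`. -/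
def dualVec : Module.Dual ℂ V →ₗ[ℂ] WithConv (HopfAlg D →ₗ[ℂ] ℂ) :=
  D.dualOf.toLinearMap ∘ₗ vecFun D.ρ

theorem dualGrp_apply (χ : G → ℂ) : D.dualGrp χ = D.dualOf (grpFun D.ρ χ) := rfl

theorem dualVec_apply (f : Module.Dual ℂ V) : D.dualVec f = D.dualOf (vecFun D.ρ f) := rfl

theorem dualGrp_one : D.dualGrp 1 = 1 := D.dualOf_one

theorem dualGrp_mul (χ χ' : G → ℂ) : D.dualGrp χ * D.dualGrp χ' = D.dualGrp (χ * χ') := by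
  rw [dualGrp_apply, dualGrp_apply, dualOf_mul, dualGrp_apply]
  congr 1
  refine linearMap_ext_left (fun g => ?_) fun v x _ => ?_
  · rw [LinearMap.comp_apply, contr_grpFun_grp, map_smul, grpFun_grp, grpFun_grp]
    rfl
  · rw [LinearMap.comp_apply, contr_grpFun_vec_mul, grpFun_vec_mul, grpFun_vec_mul]

/-- Both sides vanish on G and send vx to f(v) times the value at x of `grpFun` of the translate
χ(u·). The translate comes from the u in Δ(v). -/
theorem dualGrp_mul_dualVec (χ : G → ℂ) (f : Module.Dual ℂ V) :
    D.dualGrp χ * D.dualVec f = D.dualVec f * D.dualGrp (fun g => χ (D.u * g)) := by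
  rw [dualGrp_apply, dualVec_apply, dualOf_mul, dualGrp_apply, dualOf_mul]
  congr 1
  refine linearMap_ext_left (fun g => ?_) fun v x _ => ?_
  · rw [LinearMap.comp_apply, contr_grpFun_grp, map_smul, vecFun_grp, LinearMap.comp_apply,
      contr_vecFun_grp, grpFun_vec_mul, smul_zero]
  · rw [LinearMap.comp_apply, contr_grpFun_vec_mul, vecFun_vec_mul, grpFun_contr_apply,
      LinearMap.comp_apply, contr_vecFun_vec_mul, map_sub, grpFun_vec_mul, sub_zero, map_smul,
      smul_eq_mul]

/-- On vx the two terms of the odd Leibniz rule cancel, so f² has no component in positive degree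
and is determined by its values on G. -/
theorem dualVec_mul_self (f : Module.Dual ℂ V) :
    D.dualVec f * D.dualVec f = D.dualGrp fun g => f (D.shift g f) := by
  rw [dualVec_apply, dualOf_mul, dualGrp_apply]
  congr 1
  refine linearMap_ext_left (fun g => ?_) fun v x _ => ?_
  · rw [LinearMap.comp_apply, contr_vecFun_grp, vecFun_vec_mul, grpFun_grp, grpFun_grp,
      Pi.one_apply, mul_one]
  · rw [LinearMap.comp_apply, contr_vecFun_vec_mul, map_sub, vecFun_vec_mul, grpFun_contr_apply,
      map_smul, grpFun_vec_mul, smul_eq_mul, sub_self]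

theorem dualGrp_cosetFun_mul_dualVec (h : G ⧸ Subgroup.zpowers D.u) (f : Module.Dual ℂ V) :
    D.dualGrp (D.cosetFun h) * D.dualVec f = D.dualVec f * D.dualGrp (D.cosetFun h) := by
  rw [dualGrp_mul_dualVec]
  simp only [cosetFun_u_mul]

theorem dualGrp_cosetSign_mul_dualVec (f : Module.Dual ℂ V) :
    D.dualGrp D.cosetSign * D.dualVec f = -(D.dualVec f * D.dualGrp D.cosetSign) := by
  have h : (fun g => D.cosetSign (D.u * g)) = -D.cosetSign := funext D.cosetSign_u_mul
  rw [dualGrp_mul_dualVec, h, map_neg]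
  exact mul_neg (D.dualVec f) (D.dualGrp D.cosetSign)

/-- The map `(f, t) ↦ i f + t η` from `V^* ⊕ ℂ` to `A(G, V, u, B)^*`. -/
def generator : Module.Dual ℂ V × ℂ →ₗ[ℂ] WithConv (HopfAlg D →ₗ[ℂ] ℂ) :=
  Complex.I • D.dualVec ∘ₗ LinearMap.fst ℂ _ ℂ +
    (LinearMap.snd ℂ (Module.Dual ℂ V) ℂ).smulRight (D.dualGrp D.cosetSign)

theorem generator_apply (m : Module.Dual ℂ V × ℂ) :
    D.generator m = Complex.I • D.dualVec m.1 + m.2 • D.dualGrp D.cosetSign := rfl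

/-- The cross terms cancel because η anticommutes with V^*. The factor i turns B^{g⁻¹} - B into B -
B^{g⁻¹}. -/
theorem generator_mul_self (m : Module.Dual ℂ V × ℂ) : D.generator m * D.generator m =
    D.dualGrp fun g => D.form m.1 m.1 - D.formConj g⁻¹ m.1 m.1 + m.2 * m.2 := by
  have h : D.generator m * D.generator m =
      -(D.dualVec m.1 * D.dualVec m.1) +
        (m.2 * m.2) • (D.dualGrp D.cosetSign * D.dualGrp D.cosetSign) := by
    rw [generator_apply, add_mul, mul_add, mul_add, smul_mul_smul_comm, smul_mul_smul_comm,
      smul_mul_smul_comm, smul_mul_smul_comm, dualGrp_cosetSign_mul_dualVec, Complex.I_mul_I,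
      mul_comm m.2 Complex.I]
    simp
  rw [h, dualVec_mul_self, dualGrp_mul, cosetSign_mul_self, ← map_neg, ← map_smul, ← map_add]
  congr 1
  ext g
  simp [apply_shift]

theorem dualGrp_cosetFun_mul_generator (h : G ⧸ Subgroup.zpowers D.u) (m : Module.Dual ℂ V × ℂ) :
    D.dualGrp (D.cosetFun h) * D.generator m = D.generator m * D.dualGrp (D.cosetFun h) := by
  rw [generator_apply, mul_add, add_mul, mul_smul_comm, smul_mul_assoc, mul_smul_comm,
    smul_mul_assoc, dualGrp_cosetFun_mul_dualVec, dualGrp_mul, dualGrp_mul, mul_comm D.cosetSign]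

theorem dualGrp_cosetFun_mul_self (h : G ⧸ Subgroup.zpowers D.u) :
    D.dualGrp (D.cosetFun h) * D.dualGrp (D.cosetFun h) = D.dualGrp (D.cosetFun h) := by
  rw [dualGrp_mul, cosetFun_mul_self]

/-- The homomorphism from the Clifford algebra of the coset `h` onto the corresponding block of
`A(G, V, u, B)^*`. -/
theorem exists_blockHom (h : G ⧸ Subgroup.zpowers D.u) :
    ∃ ψ : Cl (D.blockForm h) →ₙₐ[ℂ] WithConv (HopfAlg D →ₗ[ℂ] ℂ),
      ψ 1 = D.dualGrp (D.cosetFun h) ∧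
      ∀ m, ψ (CliffordAlgebra.ι _ m) = D.dualGrp (D.cosetFun h) * D.generator m := by
  refine exists_clifford_lift _ (D.dualGrp_cosetFun_mul_self h)
    (LinearMap.mulLeft ℂ (D.dualGrp (D.cosetFun h)) ∘ₗ D.generator) (fun m => ?_) (fun m => ?_)
    fun m => ?_
  all_goals simp only [LinearMap.comp_apply, LinearMap.mulLeft_apply]
  · rw [← mul_assoc, dualGrp_cosetFun_mul_self]
  · rw [mul_assoc, ← dualGrp_cosetFun_mul_generator, ← mul_assoc, dualGrp_cosetFun_mul_self]
  · rw [mul_assoc, ← mul_assoc (D.generator m), ← dualGrp_cosetFun_mul_generator, mul_assoc,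
      ← mul_assoc, dualGrp_cosetFun_mul_self, generator_mul_self, dualGrp_mul, cosetFun_mul_form,
      map_smul]
    rfl

end Datum

/-! ### The filtration by exterior degree -/

section Filtration

variable (ρ : Representation ℂ G V)

/-- The decreasing filtration of `ℂ[G ⋉ V]` by the subspaces `Vᵏ · ℂ[G ⋉ V]`. -/
def filt (k : ℕ) : Submodule ℂ (SuperGroupAlgebra ρ) := LinearMap.range (vec ρ) ^ k * ⊤

theorem filt_zero : filt ρ 0 = ⊤ := by
  rw [filt, pow_zero, one_mul]

theorem filt_succ (k : ℕ) : filt ρ (k + 1) = LinearMap.range (vec ρ) * filt ρ k := by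
  rw [filt, filt, pow_succ', mul_assoc]

variable {ρ}

theorem vec_mul_mem_filt {k : ℕ} (v : V) {x : SuperGroupAlgebra ρ} (hx : x ∈ filt ρ k) :
    vec ρ v * x ∈ filt ρ (k + 1) := by
  rw [filt_succ]
  exact Submodule.mul_mem_mul ⟨v, rfl⟩ hx

theorem filt_eq_bot [FiniteDimensional ℂ V] : filt ρ (Module.finrank ℂ V + 1) = ⊥ := by
  have h : LinearMap.range (vec ρ) = ((LinearMap.range (ExteriorAlgebra.ι ℂ : V →ₗ[ℂ] _)).map
      ((extHom ρ).comp (Ext.of ρ).toAlgHom).toLinearMap) := by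
    rw [← LinearMap.range_comp]
    rfl
  rw [filt, h, ← Submodule.map_pow, extPower_eq_bot, Submodule.map_bot, Submodule.bot_mul]

theorem finrank_superGroupAlgebra [Fintype G] [FiniteDimensional ℂ V] :
    Module.finrank ℂ (SuperGroupAlgebra ρ) = Nat.card G * 2 ^ Module.finrank ℂ V := by
  have e : SuperGroupAlgebra ρ ≃ₗ[ℂ] (G →₀ ExteriorAlgebra ℂ V) :=
    SkewMonoidAlgebra.coeffLinearEquiv (k := Ext ρ) (S := ℂ)
  have e' := (e.trans (Finsupp.linearEquivFunOnFinite ℂ (ExteriorAlgebra ℂ V) G)).finrank_eq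
  rw [e', Module.finrank_pi_fintype, finrank_exteriorAlgebra, Finset.sum_const, Finset.card_univ,
    smul_eq_mul, Nat.card_eq_fintype_card]

instance [Fintype G] [FiniteDimensional ℂ V] : FiniteDimensional ℂ (SuperGroupAlgebra ρ) :=
  have e : SuperGroupAlgebra ρ ≃ₗ[ℂ] (G →₀ ExteriorAlgebra ℂ V) :=
    SkewMonoidAlgebra.coeffLinearEquiv (k := Ext ρ) (S := ℂ)
  LinearEquiv.finiteDimensional e.symm

/-- Modulo positive degree an element is the combination of group elements read off by the
functionals ε_g = `grpFun (Pi.single g 1)`. -/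
theorem sub_sum_mem_filt_one [Fintype G] [DecidableEq G] (x : SuperGroupAlgebra ρ) :
    x - ∑ g, grpFun ρ (Pi.single g 1) x • grp ρ g ∈ filt ρ 1 := by
  induction x using left_induction with
  | hg g =>
    simp only [grpFun_grp]
    rw [Finset.sum_eq_single g]
    · simp
    · intro h _ hh
      rw [Pi.single_eq_of_ne hh.symm, zero_smul]
    · simp
  | hadd x y hx hy =>
    simp only [map_add, add_smul, Finset.sum_add_distrib, add_sub_add_comm]
    exact add_mem hx hy
  | hsmul c x hx =>
    simp only [map_smul, smul_assoc, ← Finset.smul_sum, ← smul_sub]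
    exact Submodule.smul_mem _ c hx
  | hv v x hx =>
    simp only [grpFun_vec_mul, zero_smul, Finset.sum_const_zero, sub_zero]
    exact vec_mul_mem_filt v (by rw [filt_zero]; trivial)

end Filtration

/-! ### The Euler operator and generation of the dual algebra -/

namespace Datum

variable (D : Datum G V) [Fintype G] [FiniteDimensional ℂ V]

local notation "𝔸" => SuperGroupAlgebra D.ρ

/-- The Euler operator `∑ eᵢ (eⁱ ⌟ x)`. -/
def euler : 𝔸 →ₗ[ℂ] 𝔸 :=
  ∑ i, LinearMap.mulLeft ℂ (vec D.ρ (Module.finBasis ℂ V i)) ∘ₗ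
    D.contr (vecFun D.ρ ((Module.finBasis ℂ V).coord i))

theorem euler_apply (x : 𝔸) : D.euler x = ∑ i, vec D.ρ (Module.finBasis ℂ V i) *
    D.contr (vecFun D.ρ ((Module.finBasis ℂ V).coord i)) x := by
  simp [euler]

/-- Each left factor v adds one to the Euler degree: the first Leibniz term gives ∑ eⁱ(v)eᵢx = vx,
and in the second eᵢ anticommutes past v. -/
theorem euler_vec_mul (v : V) (x : 𝔸) :
    D.euler (vec D.ρ v * x) = vec D.ρ v * x + vec D.ρ v * D.euler x := by
  have h : vec D.ρ v = ∑ i, (Module.finBasis ℂ V).coord i v • vec D.ρ (Module.finBasis ℂ V i) := by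
    conv_lhs => rw [← (Module.finBasis ℂ V).sum_repr v]
    rw [map_sum]
    simp only [map_smul, Module.Basis.coord_apply]
  rw [euler_apply, euler_apply, Finset.mul_sum]
  conv_rhs => enter [1]; rw [h, Finset.sum_mul]
  rw [← Finset.sum_add_distrib]
  refine Finset.sum_congr rfl fun i _ => ?_
  rw [contr_vecFun_vec_mul, mul_sub, mul_smul_comm, smul_mul_assoc, ← mul_assoc, ← mul_assoc,
    vec_mul_vec D.ρ v, neg_mul, sub_eq_add_neg]

/-- The operator is not diagonal on homogeneous elements, since a group element g is sent to ∑
eᵢβ_g(eⁱ)g. The error only raises the degree, so a congruence is all that is available and all that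
is needed. -/
theorem euler_sub_mem_filt (k : ℕ) {x : 𝔸} (hx : x ∈ filt D.ρ k) :
    D.euler x - (k : ℂ) • x ∈ filt D.ρ (k + 1) := by
  induction k generalizing x with
  | zero =>
    rw [Nat.cast_zero, zero_smul, sub_zero, euler_apply]
    exact Submodule.sum_mem _ fun i _ => vec_mul_mem_filt _ (by rw [filt_zero]; trivial)
  | succ k ih =>
    rw [filt_succ] at hx
    induction hx using Submodule.mul_induction_on' with
    | mem_mul_mem v hv y hy =>
      obtain ⟨v, rfl⟩ := hv
      have h : D.euler (vec D.ρ v * y) - ((k + 1 : ℕ) : ℂ) • (vec D.ρ v * y) =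
          vec D.ρ v * (D.euler y - (k : ℂ) • y) := by
        rw [euler_vec_mul, mul_sub, mul_smul_comm, Nat.cast_succ, add_smul, one_smul]
        abel
      rw [h]
      exact vec_mul_mem_filt v (ih hy)
    | add y _ z _ hy hz =>
      rw [map_add, smul_add, add_sub_add_comm]
      exact add_mem hy hz

/-- A subspace which is stable under contractions and on which the functionals `ε_g` vanish is
zero. -/
theorem eq_bot_of_contr_mem [DecidableEq G] (N : Submodule ℂ 𝔸)
    (h0 : ∀ x ∈ N, ∀ g, grpFun D.ρ (Pi.single g 1) x = 0)
    (hc : ∀ x ∈ N, ∀ f, D.contr (vecFun D.ρ f) x ∈ N) : N = ⊥ := by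
  have h : ∀ k, N ≤ filt D.ρ k := by
    intro k
    induction k with
    | zero => rw [filt_zero]; exact le_top
    | succ k ih =>
      intro x hx
      -- For k > 0 the Euler operator sends x into degree k + 1 and is congruent to kx, so division
      -- by k raises the degree of x. For k = 0 this fails, and the vanishing of the ε_g is used
      -- instead.
      rcases Nat.eq_zero_or_pos k with rfl | hk
      · have := sub_sum_mem_filt_one x
        simpa [h0 x hx] using this
      · have hE : D.euler x ∈ filt D.ρ (k + 1) := by
          rw [euler_apply]
          exact Submodule.sum_mem _ fun i _ => vec_mul_mem_filt _ (ih (hc x hx _))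
        have h1 : (k : ℂ) • x ∈ filt D.ρ (k + 1) := by
          have := sub_mem hE (D.euler_sub_mem_filt k (ih hx))
          rwa [sub_sub_cancel] at this
        exact (Submodule.smul_mem_iff _ (Nat.cast_ne_zero.2 hk.ne')).1 h1
  rw [eq_bot_iff, ← filt_eq_bot (ρ := D.ρ)]
  exact h _

/-- The algebra `A(G, V, u, B)^*` is generated by the functionals of degree at most one. -/
theorem eq_top_of_generators_mem [DecidableEq G]
    (T : Subalgebra ℂ (WithConv (HopfAlg D →ₗ[ℂ] ℂ)))
    (hg : ∀ g, D.dualGrp (Pi.single g 1) ∈ T) (hv : ∀ f, D.dualVec f ∈ T) : T = ⊤ := by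
  let W : Submodule ℂ (Module.Dual ℂ 𝔸) := T.toSubmodule.comap D.dualOf.toLinearMap
  have hN : W.dualCoannihilator = ⊥ := by
    refine D.eq_bot_of_contr_mem _ (fun x hx g => ?_) fun x hx f => ?_
    · exact (Submodule.mem_dualCoannihilator _).1 hx _ (hg g)
    · refine (Submodule.mem_dualCoannihilator _).2 fun φ hφ => ?_
      -- Testing the contraction of x by f against φ is testing x against the product f φ, which
      -- stays in T.
      refine (Submodule.mem_dualCoannihilator _).1 hx (φ ∘ₗ D.contr (vecFun D.ρ f)) ?_
      change D.dualOf _ ∈ T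
      rw [← dualOf_mul]
      exact mul_mem (hv f) hφ
  -- In finite dimension a subspace of the dual is the annihilator of its common kernel.
  have hW : W = ⊤ := by
    rw [← Subspace.dualCoannihilator_dualAnnihilator_eq (W := W), hN,
      Submodule.dualAnnihilator_bot]
  refine eq_top_iff.2 fun x _ => ?_
  obtain ⟨φ, rfl⟩ := D.dualOf.surjective x
  have : φ ∈ W := by rw [hW]; trivial
  exact this

end Datum

/-! ### The isomorphism -/

namespace Datum

/-- The algebra `A(G, V, u, B)^*` is a product of Clifford algebras. -/
theorem nonempty_dual_algEquiv [Finite G] [FiniteDimensional ℂ V] (D : Datum G V) :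
    Nonempty (WithConv (HopfAlg D →ₗ[ℂ] ℂ) ≃ₐ[ℂ]
      ((h : G ⧸ Subgroup.zpowers D.u) → Cl (D.blockForm h))) := by
  classical
  cases nonempty_fintype G
  cases nonempty_fintype (G ⧸ Subgroup.zpowers D.u)
  choose ψ h1 hι using D.exists_blockHom
  obtain ⟨Ψ, hΨ⟩ := exists_pi_algHom ψ
    (fun h h' hh => by rw [h1, h1, dualGrp_mul, D.cosetFun_mul_of_ne hh, map_zero])
    (by simp only [h1]; rw [← map_sum, D.sum_cosetFun, dualGrp_one])
  have hmem : ∀ h c, ψ h c ∈ Ψ.range := by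
    intro h c
    refine ⟨Pi.single h c, ?_⟩
    change Ψ _ = _
    rw [hΨ, Finset.sum_eq_single h, Pi.single_eq_same]
    · intro h' _ hh
      rw [Pi.single_eq_of_ne hh, map_zero]
    · simp
  have he : ∀ h, D.dualGrp (D.cosetFun h) ∈ Ψ.range := fun h => h1 h ▸ hmem h 1
  have hgen : ∀ h m, D.dualGrp (D.cosetFun h) * D.generator m ∈ Ψ.range :=
    fun h m => hι h m ▸ hmem h _
  have hgen' : ∀ m, D.generator m ∈ Ψ.range := by
    intro m
    rw [← one_mul (D.generator m), ← dualGrp_one, ← D.sum_cosetFun, map_sum, Finset.sum_mul]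
    exact sum_mem fun h _ => hgen h m
  have hsign : D.dualGrp D.cosetSign ∈ Ψ.range := by
    -- The generator at (0, 1) is η itself.
    have := hgen' (0, 1)
    rwa [generator_apply, map_zero, smul_zero, zero_add, one_smul] at this
  have htop : Ψ.range = ⊤ := by
    refine D.eq_top_of_generators_mem _ (fun g => ?_) fun f => ?_
    · rw [D.single_eq_cosetFun, map_smul, map_add, map_smul, ← dualGrp_mul]
      exact Subalgebra.smul_mem _ (add_mem (he _)
        (Subalgebra.smul_mem _ (mul_mem (he _) hsign) _)) _
    -- The generator at (f, 0) is if, and -i · i = 1.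
    · have := Subalgebra.smul_mem _ (hgen' (f, 0)) (-Complex.I)
      rw [generator_apply, zero_smul, add_zero, smul_smul, neg_mul, Complex.I_mul_I, neg_neg,
        one_smul] at this
      exact this
  have hsurj : Function.Surjective Ψ := AlgHom.range_eq_top Ψ |>.1 htop
  have hfin : ∀ h, FiniteDimensional ℂ (Cl (D.blockForm h)) := fun h => finite_cliffordAlgebra _ _
  have : FiniteDimensional ℂ (WithConv (HopfAlg D →ₗ[ℂ] ℂ)) :=
    LinearEquiv.finiteDimensional D.dualOf
  -- The factor 2 lost in passing from G to G/⟨u⟩ is regained from the extra summand ℂ of V^* ⊕ ℂ.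
  have hrank : Module.finrank ℂ ((h : G ⧸ Subgroup.zpowers D.u) → Cl (D.blockForm h)) =
      Module.finrank ℂ (WithConv (HopfAlg D →ₗ[ℂ] ℂ)) := by
    have hG := Subgroup.card_eq_card_quotient_mul_card_subgroup (Subgroup.zpowers D.u)
    rw [Nat.card_zpowers, D.orderOf_u] at hG
    rw [← D.dualOf.finrank_eq, Subspace.dual_finrank_eq, finrank_superGroupAlgebra, hG,
      Module.finrank_pi_fintype]
    simp only [finrank_cliffordAlgebra, Module.finrank_prod, Subspace.dual_finrank_eq,
      Module.finrank_self, Finset.sum_const, Finset.card_univ, smul_eq_mul]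
    rw [Nat.card_eq_fintype_card, pow_succ]
    ring
  have hinj : Function.Injective Ψ :=
    (LinearMap.injective_iff_surjective_of_finrank_eq_finrank (f := Ψ.toLinearMap) hrank).2 hsurj
  exact ⟨(AlgEquiv.ofBijective Ψ ⟨hinj, hsurj⟩).symm⟩

end Datum

end SuperTwist

end

theorem theorem5p2 {G V : Type*} [Group G] [Finite G] [AddCommGroup V] [Module ℂ V]
    [FiniteDimensional ℂ V] (D : SuperTwist.Datum G V) :
    Nonempty (WithConv (SuperTwist.HopfAlg D →ₗ[ℂ] ℂ) ≃ₐ[ℂ]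
      ((h : G ⧸ Subgroup.zpowers D.u) → SuperTwist.Cl (D.blockForm h))) :=
  SuperTwist.Datum.nonempty_dual_algEquiv D
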